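/- Let $\mathbf H$ be a complex Hilbert space and let $A:\mathfrak D(A)\subseteq\mathbf H\to\mathbf H$ be an unbounded, positive definite, self-adjoint operator with compact resolvent. Let $\omega>0$ and $\sigma\in[0,\tfrac54)$. For $r\geq 0$ put $\mathbf H^r=\mathfrak D(A^{r/2})$, and let $\mathbf H^{-1}$ be the dual of $\mathbf H^1$. Let $\mathcal H_\omega=\mathbf H^2\times\mathbf H^1\times\mathbf H$ with the Hilbert norm $$\|(u,v,\theta)\|_{\mathcal H_\omega}^2=\|Au\|^2+\|v\|^2+\omega\|A^{1/2}v\|^2+\|\theta\|^2 .$$ Define $I+\omega A:\mathbf H^1\to\mathbf H^{-1}$ by $\langle (I+\omega A)z_1,z_2\rangle=\langle z_1,z_2\rangle+\omega\langle A^{1/2}z_1,A^{1/2}z_2\rangle$, and let $\mathbb A_\omega$ be the operator on $\mathcal H_\omega$ $$\mathbb A_\omega(u,v,\theta)=\bigl(v,\;(I+\omega A)^{-1}A^2(-u+A^{\sigma-2}\theta),\;A(-\theta-A^{\sigma-1}v)\bigr),$$ $$\mathfrak D(\mathbb A_\omega)=\bigl\{(u,v,\theta)\in\mathcal H_\omega:\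 v\in\mathbf H^2,\ -u+A^{\sigma-2}\theta\in\mathbf H^3,\ -\theta-A^{\sigma-1}v\in\mathbf H^2\bigr\},$$ associated with the thermoelastic plate system $u_{tt}+\omega Au_{tt}+A^2u-A^\sigma\theta=0$, $\theta_t+A\theta+A^\sigma u_t=0$ (here $v=u_t$). Then $\mathbb A_\omega$ is the infinitesimal generator of a $C_0$-semigroup of contractions $S_\omega(t)=e^{t\mathbb A_\omega}$ on $\mathcal H_\omega$, and this semigroup is not analytic; that is, for no $\delta\in(0,\pi/2]$ does it extend to a family $(T(z))$ of bounded operators that is holomorphic in the sector $\{z\neq0:|\arg z|<\delta\}$, satisfies $T(z+w)=T(z)T(w)$ for all $z,w$ in that sector, and satisfies $T(z)x\to x$ for every $x\in\mathcal H_\omega$ as $z\to0$ in that sector. -/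

import Mathlib

open Filter Topology
open scoped NNReal InnerProductSpace

noncomputable section

/-! ### Strictly positive self-adjoint operators and their real powers -/

section Operator

variable {H : Type*} [NormedAddCommGroup H] [InnerProductSpace ℂ H] [CompleteSpace H]

/-- `A` is an unbounded, positive definite, self-adjoint operator with compact resolvent. -/
structure IsPlateOperator (A : H →ₗ.[ℂ] H) : Prop where
  selfAdjoint : IsSelfAdjoint A
  posDef : ∃ c : ℝ, 0 < c ∧ ∀ x : A.domain, c * ‖(x : H)‖ ^ 2 ≤ (⟪(x : H), A x⟫_ℂ).re
  compactResolvent : ∃ (z : ℂ) (R : H →L[ℂ] H), IsCompactOperator R ∧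
    (∀ y : H, ∃ h : R y ∈ A.domain, z • R y - A ⟨R y, h⟩ = y) ∧
    (∀ x : A.domain, R (z • (x : H) - A x) = x)
  unbounded : ¬ ∃ C : ℝ, ∀ x : A.domain, ‖A x‖ ≤ C * ‖(x : H)‖

namespace IsPlateOperator

variable {A : H →ₗ.[ℂ] H}

lemma exists_bound (hA : IsPlateOperator A) :
    ∃ c : ℝ, 0 < c ∧ ∀ x : A.domain, c * ‖(x : H)‖ ≤ ‖A x‖ := by
  obtain ⟨c, hc, h⟩ := hA.posDef
  refine ⟨c, hc, fun x => ?_⟩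
  have h1 := (h x).trans ((Complex.re_le_norm _).trans (norm_inner_le_norm (𝕜 := ℂ) (x : H) (A x)))
  rcases eq_or_lt_of_le (norm_nonneg (x : H)) with h0 | h0
  · rw [← h0]; simp
  · nlinarith

lemma eq_zero_of_apply_eq_zero (hA : IsPlateOperator A) (x : A.domain) (h : A x = 0) : x = 0 := by
  obtain ⟨c, hc, hb⟩ := hA.exists_bound
  have h1 := hb x
  rw [h, norm_zero] at h1
  have h2 : ‖(x : H)‖ = 0 := le_antisymm (by nlinarith) (norm_nonneg _)
  exact Subtype.ext (norm_eq_zero.mp h2)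

lemma surjective (hA : IsPlateOperator A) : Function.Surjective A := by
  obtain ⟨c, hc, hb⟩ := hA.exists_bound
  -- the range is closed
  have hcl : IsClosed (Set.range A) := by
    have hcg : IsClosed (A.graph : Set (H × H)) := hA.selfAdjoint.isClosed
    have : CompleteSpace A.graph := hcg.completeSpace_coe
    let f : A.graph →L[ℂ] H := (ContinuousLinearMap.snd ℂ H H).comp A.graph.subtypeL
    have hf : AntilipschitzWith (Real.toNNReal (max 1 c⁻¹)) f := by
      refine AddMonoidHomClass.antilipschitz_of_bound f (fun p => ?_)
      obtain ⟨⟨a, b⟩, hp⟩ := p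
      obtain ⟨x, hx, hx'⟩ := (LinearPMap.mem_graph_iff _).1 hp
      simp only at hx hx'
      subst hx; subst hx'
      have h1 := hb x
      have hm : (0 : ℝ) ≤ max 1 c⁻¹ := le_trans zero_le_one (le_max_left _ _)
      rw [Real.coe_toNNReal _ hm]
      change max ‖(x : H)‖ ‖A x‖ ≤ max 1 c⁻¹ * ‖A x‖
      refine max_le ?_ ?_
      · calc ‖(x : H)‖ = c⁻¹ * (c * ‖(x : H)‖) := by field_simp
          _ ≤ c⁻¹ * ‖A x‖ := by gcongr
          _ ≤ _ := by gcongr; exact le_max_right _ _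
      · calc ‖A x‖ = 1 * ‖A x‖ := (one_mul _).symm
          _ ≤ _ := by gcongr; exact le_max_left _ _
    have hr : Set.range f = Set.range A := by
      ext y
      constructor
      · rintro ⟨⟨⟨a, b⟩, hp⟩, rfl⟩
        obtain ⟨x, hx, hx'⟩ := (LinearPMap.mem_graph_iff _).1 hp
        exact ⟨x, hx'⟩
      · rintro ⟨x, rfl⟩
        exact ⟨⟨((x : H), A x), A.mem_graph x⟩, rfl⟩
    rw [← hr]
    exact hf.isClosed_range f.uniformContinuous
  -- its orthogonal complement is trivial
  let K : Submodule ℂ H := LinearMap.range A.toFun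
  have hK : IsClosed (K : Set H) := hcl
  have hK' : CompleteSpace K := hK.completeSpace_coe
  have hperp : Kᗮ = ⊥ := by
    rw [Submodule.eq_bot_iff]
    intro y hy
    have hy' : ∀ x : A.domain, ⟪y, A x⟫_ℂ = 0 := fun x =>
      (Submodule.mem_orthogonal' K y).1 hy (A x) ⟨x, rfl⟩
    have hsa : A.adjoint = A := hA.selfAdjoint
    have hmem : y ∈ A.adjoint.domain :=
      LinearPMap.mem_adjoint_domain_of_exists y ⟨0, fun x => by rw [hy' x, inner_zero_left]⟩
    have hval : A.adjoint ⟨y, hmem⟩ = 0 :=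
      LinearPMap.adjoint_apply_eq hA.selfAdjoint.dense_domain _
        (fun x => by rw [inner_zero_left]; exact (hy' x).symm)
    have hg : (y, (0 : H)) ∈ A.graph := by
      have h2 : (y, (0 : H)) ∈ A.adjoint.graph := by
        have h2 := A.adjoint.mem_graph ⟨y, hmem⟩
        rwa [hval] at h2
      rwa [hsa] at h2
    obtain ⟨x, hx, hx'⟩ := (LinearPMap.mem_graph_iff _).1 hg
    have h3 := hA.eq_zero_of_apply_eq_zero x hx'
    rw [h3] at hx
    exact hx.symm
  have htop : K = ⊤ := (Submodule.orthogonal_eq_bot_iff).1 hperp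
  intro y
  have : y ∈ K := htop ▸ Submodule.mem_top
  exact this

/-- The bounded inverse of a positive definite self-adjoint operator exists. -/
lemma exists_inv (hA : IsPlateOperator A) : ∃ B : H →L[ℂ] H,
    (∀ y : H, ∃ h : B y ∈ A.domain, A ⟨B y, h⟩ = y) ∧ ∀ x : A.domain, B (A x) = x := by
  obtain ⟨c, hc, hb⟩ := hA.exists_bound
  have hinj : Function.Injective A.toFun := by
    rw [← LinearMap.ker_eq_bot, LinearMap.ker_eq_bot']
    exact fun x hx => hA.eq_zero_of_apply_eq_zero x hx
  let e : A.domain ≃ₗ[ℂ] H := LinearEquiv.ofBijective A.toFun ⟨hinj, hA.surjective⟩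
  have he : ∀ x : A.domain, e x = A x := fun x => rfl
  have hb' : ∀ y : H, ‖(A.domain.subtype ∘ₗ e.symm.toLinearMap) y‖ ≤ c⁻¹ * ‖y‖ := by
    intro y
    have h1 := hb (e.symm y)
    rw [← he, e.apply_symm_apply] at h1
    calc ‖((e.symm y : A.domain) : H)‖ = c⁻¹ * (c * ‖((e.symm y : A.domain) : H)‖) := by
          field_simp
      _ ≤ c⁻¹ * ‖y‖ := by gcongr
  refine ⟨(A.domain.subtype ∘ₗ e.symm.toLinearMap).mkContinuous c⁻¹ hb', fun y => ?_, fun x => ?_⟩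
  · exact ⟨(e.symm y).2, e.apply_symm_apply y⟩
  · change ((e.symm (e x) : A.domain) : H) = x
    rw [e.symm_apply_apply]

/-- The bounded inverse `A⁻¹`. -/
def inv (hA : IsPlateOperator A) : H →L[ℂ] H := Classical.choose hA.exists_inv

lemma inv_spec (hA : IsPlateOperator A) (y : H) :
    ∃ h : hA.inv y ∈ A.domain, A ⟨hA.inv y, h⟩ = y := (Classical.choose_spec hA.exists_inv).1 y

lemma inv_apply (hA : IsPlateOperator A) (x : A.domain) : hA.inv (A x) = x :=
  (Classical.choose_spec hA.exists_inv).2 x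

lemma inv_nonneg (hA : IsPlateOperator A) : 0 ≤ hA.inv := by
  rw [ContinuousLinearMap.nonneg_iff_isPositive]
  have hsa : A.adjoint = A := hA.selfAdjoint
  have hf := LinearPMap.adjoint_isFormalAdjoint hA.selfAdjoint.dense_domain
  rw [hsa] at hf
  refine ⟨fun x y => ?_, fun x => ?_⟩
  · obtain ⟨hx, hx'⟩ := hA.inv_spec x
    obtain ⟨hy, hy'⟩ := hA.inv_spec y
    have := hf ⟨_, hx⟩ ⟨_, hy⟩
    rw [hx', hy'] at this
    exact this.symm
  · obtain ⟨hx, hx'⟩ := hA.inv_spec x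
    obtain ⟨c, hc, h⟩ := hA.posDef
    have h1 := h ⟨_, hx⟩
    rw [hx'] at h1
    have h2 : (0 : ℝ) ≤ (⟪hA.inv x, x⟫_ℂ).re := le_trans (by positivity) h1
    simpa [ContinuousLinearMap.reApplyInnerSelf_apply] using h2

lemma inv_injective (hA : IsPlateOperator A) : Function.Injective hA.inv := by
  intro x y h
  obtain ⟨hx, hx'⟩ := hA.inv_spec x
  obtain ⟨hy, hy'⟩ := hA.inv_spec y
  rw [← hx', ← hy']
  congr 1
  exact Subtype.ext h

/-- The nonnegative powers of `A⁻¹` are injective, so that their inverses make sense. -/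
lemma rpow_inv_injective (hA : IsPlateOperator A) {r : ℝ} (hr : 0 < r) :
    Function.Injective (CFC.rpow hA.inv r : H →L[ℂ] H) := by
  have hB := hA.inv_nonneg
  obtain ⟨n, hn⟩ := exists_nat_gt r
  obtain ⟨s, hs⟩ : ∃ s : ℝ≥0, (s : ℝ) = n - r := ⟨⟨n - r, by linarith⟩, rfl⟩
  lift r to ℝ≥0 using hr.le
  have hs0 : 0 < s := by
    rw [← NNReal.coe_pos, hs]
    linarith
  have hr0 : 0 < r := NNReal.coe_pos.1 hr
  have h1 : hA.inv ^ s * hA.inv ^ r = hA.inv ^ n := by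
    rw [← CFC.nnrpow_add hs0 hr0, CFC.nnrpow_eq_rpow (add_pos hs0 hr0), NNReal.coe_add, hs,
      sub_add_cancel, CFC.rpow_natCast _ _ hB]
  have h2 : CFC.rpow hA.inv (r : ℝ) = hA.inv ^ r := (CFC.nnrpow_eq_rpow hr0).symm
  have h3 : ∀ (n : ℕ) (x : H), (hA.inv ^ n) x = 0 → x = 0 := by
    intro n
    induction n with
    | zero => intro x hx; simpa using hx
    | succ k ih =>
      intro x hx
      rw [pow_succ] at hx
      have h4 := ih _ hx
      exact hA.inv_injective (h4.trans (map_zero _).symm)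
  rw [h2, injective_iff_map_eq_zero]
  intro x hx
  apply h3 n
  rw [← h1, mul_apply_eq_comp, hx, map_zero]

/-- The power `A ^ r`, `r ∈ ℝ`, with its natural domain: for `r ≤ 0` it is the bounded operator
`(A⁻¹) ^ (-r)` given by the continuous functional calculus of the nonnegative operator `A⁻¹`,
and for `r > 0` it is the (unbounded) inverse of the injective bounded operator `(A⁻¹) ^ r`. -/
def pow (hA : IsPlateOperator A) (r : ℝ) : H →ₗ.[ℂ] H :=
  if r ≤ 0 then (CFC.rpow hA.inv (-r)).toLinearMap.toPMap ⊤
  else ((CFC.rpow hA.inv r).toLinearMap.toPMap ⊤).inverse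

end IsPlateOperator

end Operator

/-! ### The phase space `𝓗_ω = H² × H¹ × H` for `ω > 0` -/

section PhaseSpace

variable {H : Type*} [NormedAddCommGroup H] [InnerProductSpace ℂ H] [CompleteSpace H]
  {A : H →ₗ.[ℂ] H}

/-- The space `H² × H¹ × H`, where `H² = D(A)` and `H¹ = D(A ^ (1/2))`. -/
def PhaseSpace (hA : IsPlateOperator A) {ω : ℝ} (_hω : 0 < ω) : Type _ :=
  A.domain × (hA.pow (1 / 2)).domain × H

namespace PhaseSpace

variable {hA : IsPlateOperator A} {ω : ℝ} {hω : 0 < ω}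

instance : AddCommGroup (PhaseSpace hA hω) :=
  inferInstanceAs (AddCommGroup (A.domain × (hA.pow (1 / 2)).domain × H))

instance : Module ℂ (PhaseSpace hA hω) :=
  inferInstanceAs (Module ℂ (A.domain × (hA.pow (1 / 2)).domain × H))

/-- The displacement component `u ∈ H²`. -/
def u : PhaseSpace hA hω →ₗ[ℂ] A.domain :=
  LinearMap.fst ℂ A.domain ((hA.pow (1 / 2)).domain × H)

/-- The velocity component `v ∈ H¹`. -/
def v : PhaseSpace hA hω →ₗ[ℂ] (hA.pow (1 / 2)).domain :=
  LinearMap.fst ℂ (hA.pow (1 / 2)).domain H ∘ₗ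
    LinearMap.snd ℂ A.domain ((hA.pow (1 / 2)).domain × H)

/-- The temperature component `θ ∈ H`. -/
def θ : PhaseSpace hA hω →ₗ[ℂ] H :=
  LinearMap.snd ℂ (hA.pow (1 / 2)).domain H ∘ₗ
    LinearMap.snd ℂ A.domain ((hA.pow (1 / 2)).domain × H)

@[ext]
lemma ext {U V : PhaseSpace hA hω} (hu : u U = u V) (hv : v U = v V) (hθ : θ U = θ V) : U = V :=
  Prod.ext hu (Prod.ext hv hθ)

/-- The sesquilinear form `⟨z₁, z₂⟩ + ω ⟨A ^ (1/2) z₁, A ^ (1/2) z₂⟩` on `H¹`; it is the duality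
pairing of `(I + ω A) z₂ ∈ H⁻¹` with `z₁ ∈ H¹`. -/
def formH1 (hA : IsPlateOperator A) (ω : ℝ) (z₁ z₂ : (hA.pow (1 / 2)).domain) : ℂ :=
  ⟪(z₁ : H), (z₂ : H)⟫_ℂ + (ω : ℂ) * ⟪hA.pow (1 / 2) z₁, hA.pow (1 / 2) z₂⟫_ℂ

lemma formH1_self_re (hA : IsPlateOperator A) (ω : ℝ) (z : (hA.pow (1 / 2)).domain) :
    (formH1 hA ω z z).re = ‖(z : H)‖ ^ 2 + ω * ‖hA.pow (1 / 2) z‖ ^ 2 := by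
  have h1 : (⟪(z : H), (z : H)⟫_ℂ).re = ‖(z : H)‖ ^ 2 := inner_self_eq_norm_sq (𝕜 := ℂ) (z : H)
  have h2 : (⟪hA.pow (1 / 2) z, hA.pow (1 / 2) z⟫_ℂ).re = ‖hA.pow (1 / 2) z‖ ^ 2 :=
    inner_self_eq_norm_sq (𝕜 := ℂ) (hA.pow (1 / 2) z)
  rw [formH1, Complex.add_re, Complex.re_ofReal_mul, h1, h2]

/-- The inner product of the phase space, which induces the norm
`‖(u, v, θ)‖² = ‖A u‖² + (‖v‖² + ω ‖A ^ (1/2) v‖²) + ‖θ‖²`. -/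
@[reducible] def core : InnerProductSpace.Core ℂ (PhaseSpace hA hω) where
  inner U V := ⟪A (u U), A (u V)⟫_ℂ + formH1 hA ω (v U) (v V) + ⟪θ U, θ V⟫_ℂ
  conj_inner_symm U V := by
    simp only [formH1, map_add, map_mul, inner_conj_symm, Complex.conj_ofReal]
  re_inner_nonneg U := by
    have h1 : (⟪A (u U), A (u U)⟫_ℂ).re = _ := inner_self_eq_norm_sq (𝕜 := ℂ) (A (u U))
    have h3 : (⟪θ U, θ U⟫_ℂ).re = _ := inner_self_eq_norm_sq (𝕜 := ℂ) (θ U)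
    rw [RCLike.re_eq_complex_re]
    rw [Complex.add_re, Complex.add_re, formH1_self_re, h1, h3]
    positivity
  add_left U V W := by
    simp only [formH1, map_add, LinearPMap.map_add, Submodule.coe_add, inner_add_left]
    ring
  smul_left U V r := by
    simp only [formH1, map_smul, LinearPMap.map_smul, Submodule.coe_smul, inner_smul_left]
    ring
  definite U h := by
    have h1 : (⟪A (u U), A (u U)⟫_ℂ).re = _ := inner_self_eq_norm_sq (𝕜 := ℂ) (A (u U))
    have h3 : (⟪θ U, θ U⟫_ℂ).re = _ := inner_self_eq_norm_sq (𝕜 := ℂ) (θ U)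
    have h0 := congrArg Complex.re h
    rw [Complex.add_re, Complex.add_re, formH1_self_re, h1, h3, Complex.zero_re] at h0
    have p1 := sq_nonneg ‖A (u U)‖
    have p2 := sq_nonneg ‖((v U : (hA.pow (1 / 2)).domain) : H)‖
    have p3 := mul_nonneg hω.le (sq_nonneg ‖hA.pow (1 / 2) (v U)‖)
    have p4 := sq_nonneg ‖θ U‖
    have q1 : ‖A (u U)‖ ^ 2 = 0 := by linarith
    have q2 : ‖((v U : (hA.pow (1 / 2)).domain) : H)‖ ^ 2 = 0 := by linarith
    have q4 : ‖θ U‖ ^ 2 = 0 := by linarith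
    refine ext ?_ ?_ ?_
    · rw [map_zero]
      exact hA.eq_zero_of_apply_eq_zero _ (norm_eq_zero.1 (pow_eq_zero_iff two_ne_zero |>.1 q1))
    · rw [map_zero]
      exact Subtype.ext (norm_eq_zero.1 (pow_eq_zero_iff two_ne_zero |>.1 q2))
    · rw [map_zero]
      exact norm_eq_zero.1 (pow_eq_zero_iff two_ne_zero |>.1 q4)

instance : NormedAddCommGroup (PhaseSpace hA hω) :=
  @InnerProductSpace.Core.toNormedAddCommGroup ℂ _ _ _ _ core

instance : InnerProductSpace ℂ (PhaseSpace hA hω) :=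
  InnerProductSpace.ofCore core.toCore

end PhaseSpace

/-! ### The operator `𝔸_ω` -/

open PhaseSpace in
/-- The graph of `𝔸_ω`. The pair `(U, V)` with `U = (u, v, θ)` belongs to it if and only if
* `V.u = v` (so that `v ∈ H² = D(A)`),
* `-u + A ^ (σ - 2) θ ∈ H³ = D(A ^ (3/2))` and `(I + ω A) V.v = A² (-u + A ^ (σ - 2) θ)` in `H⁻¹`,
  that is, tested against every `z ∈ H¹`,
* `-θ - A ^ (σ - 1) v ∈ H² = D(A)` and `V.θ = A (-θ - A ^ (σ - 1) v)`. -/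
def plateGraph (hA : IsPlateOperator A) {ω : ℝ} (hω : 0 < ω) (σ : ℝ) :
    Submodule ℂ (PhaseSpace hA hω × PhaseSpace hA hω) where
  carrier := {P | ((u P.2 : A.domain) : H) = (v P.1 : (hA.pow (1 / 2)).domain) ∧
    (∃ p m : H, (θ P.1, p) ∈ (hA.pow (σ - 2)).graph ∧
      (-((u P.1 : A.domain) : H) + p, m) ∈ (hA.pow (3 / 2)).graph ∧
      ∀ z : (hA.pow (1 / 2)).domain, formH1 hA ω z (v P.2) = ⟪hA.pow (1 / 2) z, m⟫_ℂ) ∧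
    ∃ q : H, (((v P.1 : (hA.pow (1 / 2)).domain) : H), q) ∈ (hA.pow (σ - 1)).graph ∧
      (-θ P.1 - q, θ P.2) ∈ A.graph}
  add_mem' := by
    rintro P Q ⟨h1, ⟨p, m, h2, h3, h4⟩, q, h5, h6⟩ ⟨k1, ⟨p', m', k2, k3, k4⟩, q', k5, k6⟩
    refine ⟨?_, ⟨p + p', m + m', ?_, ?_, fun z => ?_⟩, q + q', ?_, ?_⟩
    · simp only [Prod.fst_add, Prod.snd_add, map_add, Submodule.coe_add, h1, k1]
    · simpa using Submodule.add_mem _ h2 k2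
    · convert Submodule.add_mem _ h3 k3 using 1
      simp only [Prod.fst_add, map_add, Submodule.coe_add, Prod.mk_add_mk, Prod.mk.injEq, and_true]
      abel
    · have e1 := h4 z
      have e2 := k4 z
      simp only [formH1, Prod.snd_add, map_add, LinearPMap.map_add, Submodule.coe_add,
        inner_add_right] at e1 e2 ⊢
      rw [← e1, ← e2]
      ring
    · simpa using Submodule.add_mem _ h5 k5
    · convert Submodule.add_mem _ h6 k6 using 1
      simp only [Prod.fst_add, Prod.snd_add, map_add, Prod.mk_add_mk, Prod.mk.injEq, and_true]
      abel
  zero_mem' := by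
    refine ⟨by simp, ⟨0, 0, ?_, ?_, fun z => ?_⟩, 0, ?_, ?_⟩
    · simp
    · simp
    · simp [formH1, LinearPMap.map_zero]
    · simp
    · simp
  smul_mem' := by
    rintro c P ⟨h1, ⟨p, m, h2, h3, h4⟩, q, h5, h6⟩
    refine ⟨?_, ⟨c • p, c • m, ?_, ?_, fun z => ?_⟩, c • q, ?_, ?_⟩
    · simp only [Prod.smul_fst, Prod.smul_snd, map_smul, Submodule.coe_smul, h1]
    · simpa using Submodule.smul_mem _ c h2
    · convert Submodule.smul_mem _ c h3 using 1
      simp only [Prod.smul_fst, map_smul, Submodule.coe_smul, Prod.smul_mk, smul_add, smul_neg]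
    · have e1 := h4 z
      simp only [formH1, Prod.smul_snd, map_smul, LinearPMap.map_smul, Submodule.coe_smul,
        inner_smul_right] at e1 ⊢
      rw [← e1]
      ring
    · simpa using Submodule.smul_mem _ c h5
    · convert Submodule.smul_mem _ c h6 using 1
      simp only [Prod.smul_fst, Prod.smul_snd, map_smul, Prod.smul_mk, smul_sub, smul_neg]

/-- The operator `𝔸_ω (u, v, θ) = (v, (I + ω A)⁻¹ (-A² u + A ^ σ θ), -A θ - A ^ σ v)`. -/
def plateOperator (hA : IsPlateOperator A) {ω : ℝ} (hω : 0 < ω) (σ : ℝ) :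
    PhaseSpace hA hω →ₗ.[ℂ] PhaseSpace hA hω :=
  (plateGraph hA hω σ).toLinearPMap

open PhaseSpace in
lemma plateGraph_functional (hA : IsPlateOperator A) {ω : ℝ} (hω : 0 < ω) (σ : ℝ)
    (P : PhaseSpace hA hω × PhaseSpace hA hω) (hP : P ∈ plateGraph hA hω σ) (h0 : P.1 = 0) :
    P.2 = 0 := by
  obtain ⟨h1, ⟨p, m, h2, h3, h4⟩, q, h5, h6⟩ := hP
  simp only [h0, map_zero, Submodule.coe_zero, neg_zero, zero_add, zero_sub] at h1 h2 h3 h5 h6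
  have hp : p = 0 := LinearPMap.graph_fst_eq_zero_snd _ h2 rfl
  have hm : m = 0 := LinearPMap.graph_fst_eq_zero_snd _ h3 hp
  have hq : q = 0 := LinearPMap.graph_fst_eq_zero_snd _ h5 rfl
  have hθ : θ P.2 = 0 := LinearPMap.graph_fst_eq_zero_snd _ h6 (by rw [hq, neg_zero])
  refine ext ?_ ?_ ?_
  · rw [map_zero]; exact Subtype.ext h1
  · rw [map_zero]
    have h7 := congrArg Complex.re (h4 (v P.2))
    rw [formH1_self_re, hm, inner_zero_right, Complex.zero_re] at h7
    have p2 := sq_nonneg ‖((v P.2 : (hA.pow (1 / 2)).domain) : H)‖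
    have p3 := mul_nonneg hω.le (sq_nonneg ‖hA.pow (1 / 2) (v P.2)‖)
    have q2 : ‖((v P.2 : (hA.pow (1 / 2)).domain) : H)‖ ^ 2 = 0 := by linarith
    exact Subtype.ext (norm_eq_zero.1 (pow_eq_zero_iff two_ne_zero |>.1 q2))
  · rw [map_zero]; exact hθ

/-- `plateGraph` is indeed the graph of `plateOperator`. -/
lemma plateOperator_graph (hA : IsPlateOperator A) {ω : ℝ} (hω : 0 < ω) (σ : ℝ) :
    (plateOperator hA hω σ).graph = plateGraph hA hω σ :=
  Submodule.toLinearPMap_graph_eq _ (plateGraph_functional hA hω σ)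

end PhaseSpace

/-! ### Semigroups -/

section Semigroup

variable {X : Type*} [NormedAddCommGroup X] [NormedSpace ℂ X]

/-- Strongly continuous (`C₀`) semigroups of bounded operators. -/
structure IsC0Semigroup (S : ℝ≥0 → X →L[ℂ] X) : Prop where
  map_zero : S 0 = ContinuousLinearMap.id ℂ X
  map_add : ∀ s t : ℝ≥0, S (s + t) = (S s).comp (S t)
  tendsto_zero : ∀ x : X, Tendsto (fun t => S t x) (𝓝[>] 0) (𝓝 x)

/-- The graph of the infinitesimal generator: the pairs `(x, y)` such that
`(S t x - x) / t → y` as `t → 0⁺`. -/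
def generatorGraph (S : ℝ≥0 → X →L[ℂ] X) : Submodule ℂ (X × X) where
  carrier := {P | Tendsto (fun t : ℝ≥0 => ((t : ℝ) : ℂ)⁻¹ • (S t P.1 - P.1)) (𝓝[>] 0) (𝓝 P.2)}
  add_mem' := by
    intro P Q hP hQ
    refine (Tendsto.add hP hQ).congr fun t => ?_
    simp only [Prod.fst_add, map_add]
    rw [← smul_add]
    congr 1
    abel
  zero_mem' := by simp
  smul_mem' := by
    intro c P hP
    refine (Tendsto.const_smul hP c).congr fun t => ?_
    simp only [Prod.smul_fst, map_smul]
    rw [← smul_sub, smul_comm]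

/-- The infinitesimal generator of a semigroup. -/
def generator (S : ℝ≥0 → X →L[ℂ] X) : X →ₗ.[ℂ] X := (generatorGraph S).toLinearPMap

/-- `generatorGraph` is indeed the graph of `generator`. -/
lemma generator_graph (S : ℝ≥0 → X →L[ℂ] X) : (generator S).graph = generatorGraph S := by
  refine Submodule.toLinearPMap_graph_eq _ ?_
  rintro ⟨x, y⟩ hP h0
  simp only at h0
  subst h0
  have hP' : Tendsto (fun t : ℝ≥0 => ((t : ℝ) : ℂ)⁻¹ • (S t 0 - 0)) (𝓝[>] 0) (𝓝 y) := hP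
  simp only [map_zero, sub_zero, smul_zero] at hP'
  exact tendsto_nhds_unique hP' tendsto_const_nhds

/-- The open sector `{z ≠ 0 : |arg z| < δ}`. -/
def sector (δ : ℝ) : Set ℂ := {z | z ≠ 0 ∧ |z.arg| < δ}

/-- The semigroup `S` is analytic: it extends to a holomorphic, strongly continuous at `0`
semigroup of bounded operators on some open sector around the positive half-axis. -/
def IsAnalyticSemigroup (S : ℝ≥0 → X →L[ℂ] X) : Prop :=
  ∃ δ : ℝ, 0 < δ ∧ δ ≤ Real.pi / 2 ∧ ∃ T : ℂ → X →L[ℂ] X,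
    (∀ t : ℝ≥0, T ((t : ℝ) : ℂ) = S t) ∧
    DifferentiableOn ℂ T (sector δ) ∧
    (∀ z ∈ sector δ, ∀ w ∈ sector δ, T (z + w) = (T z).comp (T w)) ∧
    ∀ x : X, Tendsto (fun z => T z x) (𝓝[sector δ] 0) (𝓝 x)

end Semigroup

end

/-!
Write `J ^ s = A ^ (-s)` for `s ≥ 0`, a bounded self-adjoint operator. In the coordinates
`(a, b, h) = (A u, A ^ (1/2) v, θ)` the phase space is a renormed copy of `H × H × H`, and solving
`𝔸_ω U = V` explicitly shows that the plate operator is the inverse of the bounded operator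
`(a, b, h) ↦ (-J ^ (3 - 2σ) a - J ^ (2 - σ) h - J ^ (1/2) (J + ω) b, J ^ (1/2) a,
-J ^ (2 - σ) a - J h)` (`mem_plateGraph_iff`), whose exponents are nonnegative for `σ ≤ 3/2`.
The real part of its quadratic form is `-‖J ^ (3/2 - σ) a + J ^ (1/2) h‖ ^ 2`, so it is dissipative
(`re_inner_plateInv_nonpos`).

Generation: if `B` is bounded, injective and dissipative on a Hilbert space, then `B⁻¹` generates a
contraction semigroup (`exists_contraction_semigroup`). The operators `(B - ε)⁻¹` are bounded,
commute and are dissipative, so their exponentials are contractions which converge strongly as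
`ε → 0`.

Non-analyticity: since `A` is unbounded and `A⁻¹` is compact and self-adjoint, `A⁻¹` has arbitrarily
small eigenvalues `ν` (`IsPlateOperator.exists_small_eigenvalue`). On the eigenspace for `ν` the
plate operator has the eigenvalues `λ = ν ^ (-1/2) z` with
`(1 + ν ^ (1/2) z) (1 + (ν + ω) z ^ 2) + ν ^ (5/2 - 2σ) z = 0`. As `ν → 0` this equation
degenerates to `1 + ω z ^ 2 = 0`, exactly because `σ < 5/4`, so a root `z` tends to `i / √ω`
(`eventually_exists_root`). Hence there are eigenvalues `λ` of large modulus close to the imaginary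
direction. If the semigroup had an analytic extension `T`, then `T ζ` would have the eigenvalue
`e ^ (λ ζ)` for every `ζ` in the sector (`extension_apply_eigenvector`); for `ζ` slightly below the
real axis these are unbounded, which contradicts the boundedness of `T ζ`
(`not_isAnalyticSemigroup`).
-/

noncomputable section

/-! ### Generation of contraction semigroups from a dissipative bounded inverse -/

section Generation

variable {X : Type*} [NormedAddCommGroup X] [InnerProductSpace ℂ X] [CompleteSpace X]

/-- The exponential `e ^ (tC)` of a bounded operator `C`, for real times `t`. -/
def expOp (C : X →L[ℂ] X) (t : ℝ) : X →L[ℂ] X := NormedSpace.exp (t • C)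

lemma expOp_zero (C : X →L[ℂ] X) : expOp C 0 = 1 := by
  simp [expOp]

lemma expOp_add (C : X →L[ℂ] X) (s t : ℝ) : expOp C (s + t) = expOp C s * expOp C t := by
  let _ : NormedAlgebra ℚ (X →L[ℂ] X) := .restrictScalars ℚ ℝ _
  rw [expOp, add_smul]
  exact NormedSpace.exp_add_of_commute (((Commute.refl C).smul_left s).smul_right t)

lemma hasDerivAt_expOp (C : X →L[ℂ] X) (t : ℝ) : HasDerivAt (expOp C) (expOp C t * C) t :=
  hasDerivAt_exp_smul_const C t

lemma commute_expOp {C D : X →L[ℂ] X} (h : Commute C D) (t : ℝ) : Commute C (expOp D t) :=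
  (h.smul_right t).exp_right

lemma hasDerivAt_expOp_apply (C : X →L[ℂ] X) (x : X) (t : ℝ) :
    HasDerivAt (fun t => expOp C t x) (C (expOp C t x)) t := by
  have h := (ContinuousLinearMap.apply ℂ X x).restrictScalars ℝ |>.hasFDerivAt.comp_hasDerivAt t
    (hasDerivAt_expOp C t)
  rw [← (commute_expOp (Commute.refl C) t).eq] at h
  exact h

/-- A bounded dissipative operator generates contractions, as the derivative of
`‖e ^ (tC) x‖ ^ 2` is `2 Re ⟪C e ^ (tC) x, e ^ (tC) x⟫ ≤ 0`. -/
lemma norm_expOp_apply_le {C : X →L[ℂ] X} (hC : ∀ x, (⟪C x, x⟫_ℂ).re ≤ 0) {t : ℝ} (ht : 0 ≤ t)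
    (x : X) : ‖expOp C t x‖ ≤ ‖x‖ := by
  let _ : InnerProductSpace ℝ X := InnerProductSpace.rclikeToReal ℂ X
  have hd : ∀ t, HasDerivAt (fun t => ‖expOp C t x‖ ^ 2)
      (2 * (⟪expOp C t x, C (expOp C t x)⟫_ℂ).re) t := fun t =>
    (hasDerivAt_expOp_apply C x t).norm_sq
  have hanti : Antitone (fun t => ‖expOp C t x‖ ^ 2) := by
    refine antitone_of_deriv_nonpos (fun t => (hd t).differentiableAt) fun t => ?_
    rw [(hd t).deriv]
    have h1 := hC (expOp C t x)
    have h2 : (⟪expOp C t x, C (expOp C t x)⟫_ℂ).re = (⟪C (expOp C t x), expOp C t x⟫_ℂ).re :=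
      inner_re_symm (𝕜 := ℂ) _ _
    linarith
  have h := hanti ht
  simp only [expOp_zero, one_apply_eq_self] at h
  exact (sq_le_sq₀ (norm_nonneg _) (norm_nonneg _)).1 h

/-- The exponentials of commuting dissipative operators are compared by differentiating
`e ^ ((t - s) D) e ^ (sC) x` in `s`. -/
lemma norm_expOp_sub_expOp_le {C D : X →L[ℂ] X} (hC : ∀ x, (⟪C x, x⟫_ℂ).re ≤ 0)
    (hD : ∀ x, (⟪D x, x⟫_ℂ).re ≤ 0) (hCD : Commute C D) {t : ℝ} (ht : 0 ≤ t) (x : X) :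
    ‖expOp C t x - expOp D t x‖ ≤ t * ‖C x - D x‖ := by
  have hd : ∀ s, HasDerivAt (fun s => expOp D (t - s) (expOp C s x))
      (expOp D (t - s) (expOp C s (C x - D x))) s := by
    intro s
    have h1 : HasDerivAt (fun s => expOp D (t - s)) (-(expOp D (t - s) * D)) s := by
      have h := (hasDerivAt_expOp D (t - s)).scomp s ((hasDerivAt_id s).const_sub t)
      rwa [neg_one_smul] at h
    have h2 := (ContinuousLinearMap.apply ℂ X x).restrictScalars ℝ |>.hasFDerivAt.comp_hasDerivAt s
      (h1.mul (hasDerivAt_expOp C s))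
    refine h2.congr_deriv ?_
    have h3 : D (expOp C s x) = expOp C s (D x) :=
      DFunLike.congr_fun (commute_expOp hCD.symm s).eq x
    change -(expOp D (t - s) (D (expOp C s x))) + expOp D (t - s) (expOp C s (C x)) = _
    rw [h3, map_sub, map_sub]
    abel
  have h := norm_image_sub_le_of_norm_deriv_le_segment' (a := 0) (b := t)
    (C := ‖C x - D x‖) (fun s _ => (hd s).hasDerivWithinAt)
    (fun s hs => (norm_expOp_apply_le hD (by linarith [hs.2]) _).trans
      (norm_expOp_apply_le hC hs.1 _)) t ⟨ht, le_rfl⟩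
  simpa [expOp_zero, mul_comm] using h

/-- A bounded dissipative operator minus a positive multiple of the identity is invertible. -/
lemma isUnit_sub_smul_one {B : X →L[ℂ] X} (hB : ∀ x, (⟪B x, x⟫_ℂ).re ≤ 0) {ε : ℝ} (hε : 0 < ε) :
    IsUnit (B - (ε : ℂ) • (1 : X →L[ℂ] X)) := by
  refine ContinuousLinearMap.isUnit_of_forall_le_norm_inner_map _
    (c := ⟨ε, hε.le⟩) hε fun x => ?_
  have h1 : (⟪(B - (ε : ℂ) • (1 : X →L[ℂ] X)) x, x⟫_ℂ).re = (⟪B x, x⟫_ℂ).re - ε * ‖x‖ ^ 2 := by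
    have h : (⟪x, x⟫_ℂ).re = ‖x‖ ^ 2 := inner_self_eq_norm_sq (𝕜 := ℂ) x
    rw [sub_apply, inner_sub_left, Complex.sub_re,
      smul_apply, one_apply_eq_self, inner_smul_left, Complex.conj_ofReal,
      Complex.re_ofReal_mul, h]
  have h2 := (neg_le_abs _).trans (Complex.abs_re_le_norm ⟪(B - (ε : ℂ) • (1 : X →L[ℂ] X)) x, x⟫_ℂ)
  have h3 := hB x
  change ‖x‖ ^ 2 * ε ≤ _
  linarith

/-- The Yosida-type approximation `(B - 1 / (n + 1))⁻¹` of the possibly unbounded `B⁻¹`. -/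
def yosida (B : X →L[ℂ] X) (n : ℕ) : X →L[ℂ] X :=
  Ring.inverse (B - ((1 / ((n : ℝ) + 1) : ℝ) : ℂ) • (1 : X →L[ℂ] X))

section Yosida

variable {B : X →L[ℂ] X} (hB : ∀ x, (⟪B x, x⟫_ℂ).re ≤ 0)
include hB

lemma yosida_spec (n : ℕ) (x : X) :
    B (yosida B n x) = x + ((1 / ((n : ℝ) + 1) : ℝ) : ℂ) • yosida B n x := by
  have h := Ring.mul_inverse_cancel _
    (isUnit_sub_smul_one hB (ε := 1 / ((n : ℝ) + 1)) (by positivity))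
  have h1 := DFunLike.congr_fun h x
  change B (yosida B n x) - ((1 / ((n : ℝ) + 1) : ℝ) : ℂ) • yosida B n x = x at h1
  exact sub_eq_iff_eq_add.1 h1

lemma yosida_commute_self (n : ℕ) : Commute (yosida B n) B := by
  have h : Commute B (B - ((1 / ((n : ℝ) + 1) : ℝ) : ℂ) • (1 : X →L[ℂ] X)) :=
    (Commute.refl B).sub_right ((Commute.one_right B).smul_right _)
  obtain ⟨w, hw⟩ := isUnit_sub_smul_one hB (ε := 1 / ((n : ℝ) + 1)) (by positivity)
  rw [yosida, ← hw, Ring.inverse_unit]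
  rw [← hw] at h
  exact h.units_inv_right.symm

lemma yosida_commute (n m : ℕ) : Commute (yosida B n) (yosida B m) := by
  have h : Commute (yosida B n) (B - ((1 / ((m : ℝ) + 1) : ℝ) : ℂ) • (1 : X →L[ℂ] X)) :=
    (yosida_commute_self hB n).sub_right ((Commute.one_right _).smul_right _)
  obtain ⟨w, hw⟩ := isUnit_sub_smul_one hB (ε := 1 / ((m : ℝ) + 1)) (by positivity)
  rw [← hw] at h
  rw [yosida.eq_def B m, ← hw, Ring.inverse_unit]
  exact h.units_inv_right

lemma yosida_re_inner (n : ℕ) (x : X) :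
    (⟪yosida B n x, x⟫_ℂ).re ≤ -(1 / ((n : ℝ) + 1)) * ‖yosida B n x‖ ^ 2 := by
  have h1 := yosida_spec hB n x
  have h2 := hB (yosida B n x)
  have h3 : (⟪yosida B n x, yosida B n x⟫_ℂ).re = ‖yosida B n x‖ ^ 2 :=
    inner_self_eq_norm_sq (𝕜 := ℂ) _
  rw [h1, inner_add_left, inner_smul_left, Complex.conj_ofReal, Complex.add_re,
    Complex.re_ofReal_mul, h3] at h2
  have h4 : (⟪x, yosida B n x⟫_ℂ).re = (⟪yosida B n x, x⟫_ℂ).re := inner_re_symm (𝕜 := ℂ) _ _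
  linarith

lemma yosida_dissipative (n : ℕ) (x : X) : (⟪yosida B n x, x⟫_ℂ).re ≤ 0 := by
  refine (yosida_re_inner hB n x).trans ?_
  have : 0 ≤ (1 / ((n : ℝ) + 1)) * ‖yosida B n x‖ ^ 2 := by positivity
  linarith

lemma norm_smul_yosida_le (n : ℕ) (x : X) : (1 / ((n : ℝ) + 1)) * ‖yosida B n x‖ ≤ ‖x‖ := by
  have h1 := yosida_re_inner hB n x
  have h2 := (neg_le_abs _).trans ((Complex.abs_re_le_norm ⟪yosida B n x, x⟫_ℂ).trans
    (norm_inner_le_norm (𝕜 := ℂ) _ _))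
  rcases eq_or_lt_of_le (norm_nonneg (yosida B n x)) with h0 | h0
  · rw [← h0]; simp
  · nlinarith

lemma norm_yosida_apply_le (n : ℕ) (x : X) : ‖yosida B n (B x)‖ ≤ 2 * ‖x‖ := by
  have h1 : yosida B n (B x) = B (yosida B n x) :=
    DFunLike.congr_fun (yosida_commute_self hB n).eq x
  rw [h1, yosida_spec hB]
  have h2 := norm_smul_yosida_le hB n x
  refine (norm_add_le _ _).trans ?_
  rw [norm_smul, Complex.norm_real, Real.norm_of_nonneg (by positivity)]
  linarith

/-- The range of an injective dissipative operator is dense: for `y` orthogonal to it, the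
inequality `Re ⟪B (y + s • B y), y + s • B y⟫ ≤ 0` for small `s > 0` forces `B y = 0`. -/
lemma denseRange_of_dissipative (hinj : Function.Injective B) : DenseRange B := by
  have hperp : (LinearMap.range B.toLinearMap)ᗮ = ⊥ := by
    rw [Submodule.eq_bot_iff]
    intro y hy
    have hy' : ∀ x, ⟪B x, y⟫_ℂ = 0 := fun x => (Submodule.mem_orthogonal _ y).1 hy _ ⟨x, rfl⟩
    have key : ∀ s : ℝ, 0 < s → ‖B y‖ ^ 2 ≤ s * ‖⟪B (B y), B y⟫_ℂ‖ := by
      intro s hs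
      have h1 := hB (y + (s : ℂ) • B y)
      have h3 : (⟪B y, B y⟫_ℂ).re = ‖B y‖ ^ 2 := inner_self_eq_norm_sq (𝕜 := ℂ) _
      rw [map_add, map_smul, inner_add_left, inner_add_right, inner_add_right, inner_smul_left,
        inner_smul_left, inner_smul_right, inner_smul_right, hy', hy', Complex.conj_ofReal] at h1
      simp only [mul_zero, zero_add, Complex.add_re, Complex.re_ofReal_mul, h3] at h1
      have h2 := (neg_le_abs _).trans (Complex.abs_re_le_norm ⟪B (B y), B y⟫_ℂ)
      have h4 : s * (‖B y‖ ^ 2 + s * (⟪B (B y), B y⟫_ℂ).re) ≤ 0 := by linarith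
      have h5 : ‖B y‖ ^ 2 + s * (⟪B (B y), B y⟫_ℂ).re ≤ 0 := by
        by_contra! h
        exact absurd h4 (not_le.2 (mul_pos hs h))
      nlinarith
    have h0 : ‖B y‖ ^ 2 ≤ 0 := by
      have ht : Tendsto (fun s : ℝ => s * ‖⟪B (B y), B y⟫_ℂ‖) (𝓝[>] 0) (𝓝 0) := by
        have : Tendsto (fun s : ℝ => s * ‖⟪B (B y), B y⟫_ℂ‖) (𝓝 0) (𝓝 (0 * ‖⟪B (B y), B y⟫_ℂ‖)) :=
          tendsto_id.mul_const _
        rw [zero_mul] at this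
        exact this.mono_left nhdsWithin_le_nhds
      exact ge_of_tendsto ht (by filter_upwards [self_mem_nhdsWithin] with s hs using key s hs)
    have h6 : B y = 0 := norm_eq_zero.1 (pow_eq_zero_iff two_ne_zero |>.1
      (le_antisymm h0 (sq_nonneg _)))
    exact hinj (h6.trans (map_zero B).symm)
  have := Submodule.topologicalClosure_eq_top_iff.2 hperp
  rwa [Submodule.eq_top_iff'] at this

lemma tendsto_yosida (hd : DenseRange B) (x : X) :
    Tendsto (fun n => yosida B n (B x)) atTop (𝓝 x) := by
  have hε := tendsto_one_div_add_atTop_nhds_zero_nat (𝕜 := ℝ)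
  have h1 : ∀ y : X, Tendsto (fun n => yosida B n (B (B y))) atTop (𝓝 (B y)) := by
    intro y
    rw [tendsto_iff_norm_sub_tendsto_zero]
    refine squeeze_zero (fun _ => norm_nonneg _) (fun n => ?_)
      ((hε.mul_const (2 * ‖y‖)).trans (by simp))
    have h2 : yosida B n (B (B y)) = B (yosida B n (B y)) :=
      DFunLike.congr_fun (yosida_commute_self hB n).eq (B y)
    rw [h2, yosida_spec hB, add_sub_cancel_left, norm_smul, Complex.norm_real,
      Real.norm_of_nonneg (by positivity)]
    gcongr
    exact norm_yosida_apply_le hB n y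
  rw [Metric.tendsto_atTop]
  intro η hη
  obtain ⟨y, hy⟩ := hd.exists_dist_lt x (ε := η / 4) (by positivity)
  obtain ⟨N, hN⟩ := Metric.tendsto_atTop.1 (h1 y) (η / 4) (by positivity)
  refine ⟨N, fun n hn => ?_⟩
  have h3 := hN n hn
  rw [dist_eq_norm] at hy h3 ⊢
  have h4 := norm_yosida_apply_le hB n (x - B y)
  have h5 : yosida B n (B x) - x =
      yosida B n (B (x - B y)) + (yosida B n (B (B y)) - B y) - (x - B y) := by
    simp only [map_sub]; abel
  rw [h5]
  calc _ ≤ ‖yosida B n (B (x - B y))‖ + ‖yosida B n (B (B y)) - B y‖ + ‖x - B y‖ :=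
        (norm_sub_le _ _).trans (by gcongr; exact norm_add_le _ _)
    _ < η := by linarith

lemma exists_tendsto_expOp_yosida (hd : DenseRange B) {t : ℝ} (ht : 0 ≤ t) (x : X) :
    ∃ y, Tendsto (fun n => expOp (yosida B n) t x) atTop (𝓝 y) := by
  have hc := yosida_dissipative hB
  refine cauchySeq_tendsto_of_complete (Metric.cauchySeq_iff.2 fun η hη => ?_)
  obtain ⟨y, hy⟩ := hd.exists_dist_lt x (ε := η / 4) (by positivity)
  obtain ⟨N, hN⟩ := Metric.cauchySeq_iff.1 (tendsto_yosida hB hd y).cauchySeq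
    (η / (4 * (t + 1))) (by positivity)
  refine ⟨N, fun m hm n hn => ?_⟩
  have h1 := hN m hm n hn
  rw [dist_eq_norm] at hy h1 ⊢
  have h2 := norm_expOp_sub_expOp_le (hc m) (hc n) (yosida_commute hB m n) ht (B y)
  have h3 := norm_expOp_apply_le (hc m) ht (x - B y)
  have h4 := norm_expOp_apply_le (hc n) ht (x - B y)
  have h5 : t * ‖yosida B m (B y) - yosida B n (B y)‖ ≤ η / 4 := by
    calc _ ≤ (t + 1) * (η / (4 * (t + 1))) := by gcongr; linarith
      _ = η / 4 := by field_simp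
  have h6 : expOp (yosida B m) t x - expOp (yosida B n) t x =
      expOp (yosida B m) t (x - B y) + (expOp (yosida B m) t (B y) - expOp (yosida B n) t (B y))
        - expOp (yosida B n) t (x - B y) := by
    simp only [map_sub]; abel
  rw [h6]
  calc _ ≤ ‖expOp (yosida B m) t (x - B y)‖ +
        ‖expOp (yosida B m) t (B y) - expOp (yosida B n) t (B y)‖ +
        ‖expOp (yosida B n) t (x - B y)‖ :=
          (norm_sub_le _ _).trans (by gcongr; exact norm_add_le _ _)
    _ < η := by linarith

end Yosida

omit [CompleteSpace X] in
/-- The generator of a contraction semigroup is dissipative. -/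
lemma re_inner_nonpos_of_mem_generatorGraph {S : ℝ≥0 → X →L[ℂ] X} (hS : ∀ t, ‖S t‖ ≤ 1)
    {P : X × X} (hP : P ∈ generatorGraph S) : (⟪P.2, P.1⟫_ℂ).re ≤ 0 := by
  have hP' : Tendsto (fun t : ℝ≥0 => ((t : ℝ) : ℂ)⁻¹ • (S t P.1 - P.1)) (𝓝[>] 0) (𝓝 P.2) := hP
  have h1 := Complex.continuous_re.tendsto _ |>.comp (hP'.inner (tendsto_const_nhds (x := P.1)))
  refine le_of_tendsto h1 (Eventually.of_forall fun t => ?_)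
  have h2 : (⟪S t P.1, P.1⟫_ℂ).re ≤ ‖P.1‖ ^ 2 := by
    refine (Complex.re_le_norm _).trans ((norm_inner_le_norm (𝕜 := ℂ) _ _).trans ?_)
    have := (S t).le_of_opNorm_le (hS t) P.1
    nlinarith [norm_nonneg P.1]
  have h3 : (⟪P.1, P.1⟫_ℂ).re = ‖P.1‖ ^ 2 := inner_self_eq_norm_sq (𝕜 := ℂ) _
  simp only [Function.comp_apply]
  rw [← Complex.ofReal_inv, inner_smul_left, Complex.conj_ofReal, Complex.re_ofReal_mul,
    inner_sub_left, Complex.sub_re, h3]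
  exact mul_nonpos_of_nonneg_of_nonpos (by positivity) (by linarith)

/-- If `B` is bounded, injective and dissipative, then `B⁻¹` generates a contraction semigroup. -/
theorem exists_contraction_semigroup {B : X →L[ℂ] X} (hB : ∀ x, (⟪B x, x⟫_ℂ).re ≤ 0)
    (hinj : Function.Injective B) : ∃ S : ℝ≥0 → X →L[ℂ] X, IsC0Semigroup S ∧ (∀ t, ‖S t‖ ≤ 1) ∧
      ∀ P : X × X, P ∈ generatorGraph S ↔ B P.2 = P.1 := by
  have hd := denseRange_of_dissipative hB hinj
  have hc := yosida_dissipative hB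
  choose f hf using fun t : ℝ≥0 => exists_tendsto_expOp_yosida hB hd t.2
  let S : ℝ≥0 → X →L[ℂ] X := fun t =>
    continuousLinearMapOfTendsto (fun n => expOp (yosida B n) (t : ℝ)) (tendsto_pi_nhds.2 (hf t))
  have hS : ∀ (t : ℝ≥0) x, Tendsto (fun n => expOp (yosida B n) (t : ℝ) x) atTop (𝓝 (S t x)) := hf
  have hSle : ∀ (t : ℝ≥0) x, ‖S t x‖ ≤ ‖x‖ := fun t x =>
    le_of_tendsto (hS t x).norm (Eventually.of_forall fun n => norm_expOp_apply_le (hc n) t.2 x)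
  have hS1 : ∀ t, ‖S t‖ ≤ 1 := fun t =>
    (S t).opNorm_le_bound zero_le_one fun x => by rw [one_mul]; exact hSle t x
  have hest : ∀ (t : ℝ≥0) (n : ℕ) (x : X),
      ‖S t (B x) - expOp (yosida B n) t (B x)‖ ≤ t * ‖x - yosida B n (B x)‖ := by
    intro t n x
    refine le_of_tendsto_of_tendsto ((hS t (B x)).sub_const _).norm
      (((tendsto_yosida hB hd x).sub_const _).norm.const_mul (t : ℝ))
      (Eventually.of_forall fun m => ?_)
    exact norm_expOp_sub_expOp_le (hc m) (hc n) (yosida_commute hB m n) t.2 (B x)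
  -- `B⁻¹` is contained in the generator
  have hgen : ∀ x, (B x, x) ∈ generatorGraph S := by
    intro x
    change Tendsto (fun t : ℝ≥0 => ((t : ℝ) : ℂ)⁻¹ • (S t (B x) - B x)) (𝓝[>] (0 : ℝ≥0)) (𝓝 x)
    rw [Metric.tendsto_nhds]
    intro η hη
    obtain ⟨n, hn⟩ := (Metric.tendsto_nhds.1 (tendsto_yosida hB hd x) (η / 4)
      (by positivity)).exists
    have h1 : Tendsto (fun t : ℝ => t⁻¹ • (expOp (yosida B n) t (B x) - B x)) (𝓝[>] (0 : ℝ))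
        (𝓝 (yosida B n (B x))) := by
      have := (hasDerivAt_expOp_apply (yosida B n) (B x) 0).tendsto_slope_zero_right
      simpa [expOp_zero] using this
    have h2 : Tendsto (fun t : ℝ≥0 => (t : ℝ)) (𝓝[>] (0 : ℝ≥0)) (𝓝[>] (0 : ℝ)) := by
      refine tendsto_nhdsWithin_of_tendsto_nhds_of_eventually_within _
        ((NNReal.continuous_coe.tendsto 0).mono_left nhdsWithin_le_nhds) ?_
      filter_upwards [self_mem_nhdsWithin] with t ht using NNReal.coe_pos.2 ht
    filter_upwards [Metric.tendsto_nhds.1 (h1.comp h2) (η / 4) (by positivity),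
      self_mem_nhdsWithin] with t ht ht0
    have ht0' : (0 : ℝ) < t := NNReal.coe_pos.2 ht0
    simp only [Function.comp_apply, dist_eq_norm] at ht hn ⊢
    have h3 : ‖((t : ℝ) : ℂ)⁻¹ • (S t (B x) - expOp (yosida B n) t (B x))‖ ≤ η / 4 := by
      rw [norm_smul, norm_inv, Complex.norm_real, Real.norm_of_nonneg ht0'.le,
        inv_mul_le_iff₀ ht0']
      refine (hest t n x).trans ?_
      rw [norm_sub_rev]
      gcongr
    have h4 : ((t : ℝ) : ℂ)⁻¹ • (S t (B x) - B x) - x =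
        ((t : ℝ) : ℂ)⁻¹ • (S t (B x) - expOp (yosida B n) t (B x)) +
        ((t : ℝ)⁻¹ • (expOp (yosida B n) t (B x) - B x) - yosida B n (B x)) +
        (yosida B n (B x) - x) := by
      rw [← Complex.ofReal_inv, Complex.coe_smul, Complex.coe_smul]
      simp only [smul_sub]
      abel
    rw [h4]
    calc _ ≤ _ := norm_add₃_le
      _ < η := by linarith
  refine ⟨S, ⟨?_, fun s t => ?_, fun x => ?_⟩, hS1, fun P => ⟨fun hP => ?_, fun hP => ?_⟩⟩
  · ext x
    refine tendsto_nhds_unique (hS 0 x) ?_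
    simp [expOp_zero]
  · ext x
    refine tendsto_nhds_unique (hS (s + t) x) ?_
    have h1 : Tendsto (fun n => expOp (yosida B n) s (S t x) +
        expOp (yosida B n) s (expOp (yosida B n) t x - S t x)) atTop (𝓝 (S s (S t x) + 0)) := by
      refine (hS s _).add (squeeze_zero_norm (fun n => norm_expOp_apply_le (hc n) s.2 _) ?_)
      exact tendsto_iff_norm_sub_tendsto_zero.1 (hS t x)
    rw [add_zero] at h1
    refine h1.congr fun n => ?_
    rw [← map_add, add_sub_cancel, NNReal.coe_add, expOp_add]
    rfl
  · -- strong continuity holds on the dense range of `B` because difference quotients converge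
    have hr : ∀ y, Tendsto (fun t => S t (B y)) (𝓝[>] (0 : ℝ≥0)) (𝓝 (B y)) := by
      intro y
      have h1 : Tendsto (fun t : ℝ≥0 => ((t : ℝ) : ℂ)) (𝓝[>] 0) (𝓝 0) := by
        have := (Complex.continuous_ofReal.comp NNReal.continuous_coe).tendsto (0 : ℝ≥0)
        simp only [Function.comp_apply, NNReal.coe_zero, Complex.ofReal_zero] at this
        exact this.mono_left nhdsWithin_le_nhds
      have h2 := (h1.smul (hgen y)).add_const (B y)
      simp only [zero_smul, zero_add] at h2
      refine h2.congr' ?_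
      filter_upwards [self_mem_nhdsWithin] with t ht
      have ht0 : ((t : ℝ) : ℂ) ≠ 0 := by
        exact_mod_cast (NNReal.coe_pos.2 ht).ne'
      rw [smul_inv_smul₀ ht0, sub_add_cancel]
    rw [Metric.tendsto_nhds]
    intro η hη
    obtain ⟨y, hy⟩ := hd.exists_dist_lt x (ε := η / 4) (by positivity)
    filter_upwards [Metric.tendsto_nhds.1 (hr y) (η / 4) (by positivity)] with t ht
    rw [dist_eq_norm] at hy ht ⊢
    have h1 : S t x - x = S t (x - B y) + (S t (B y) - B y) - (x - B y) := by
      simp only [map_sub]; abel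
    have h2 := hSle t (x - B y)
    rw [h1]
    calc _ ≤ ‖S t (x - B y)‖ + ‖S t (B y) - B y‖ + ‖x - B y‖ :=
          (norm_sub_le _ _).trans (by gcongr; exact norm_add_le _ _)
      _ < η := by linarith
  · -- `1 - B⁻¹` is onto and the generator is dissipative, so it cannot be larger than `B⁻¹`
    obtain ⟨z, hz⟩ := (ContinuousLinearMap.isUnit_iff_bijective.1
      (isUnit_sub_smul_one hB (ε := 1) one_pos)).2 (P.1 - P.2)
    have hz' : B z - z = P.1 - P.2 := by simpa using hz
    have h1 := re_inner_nonpos_of_mem_generatorGraph hS1 (Submodule.sub_mem _ hP (hgen z))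
    have h2 : P.1 - B z = P.2 - z := by
      have h3 := congrArg (fun w => P.1 - w - z) hz'
      simp only [sub_sub_cancel] at h3
      rw [← h3]; abel
    simp only [Prod.fst_sub, Prod.snd_sub, h2] at h1
    have h3 : (⟪P.2 - z, P.2 - z⟫_ℂ).re = ‖P.2 - z‖ ^ 2 := inner_self_eq_norm_sq (𝕜 := ℂ) _
    rw [h3] at h1
    have h4 : P.2 - z = 0 := norm_eq_zero.1 (pow_eq_zero_iff two_ne_zero |>.1
      (le_antisymm h1 (sq_nonneg _)))
    rw [h4, sub_eq_zero] at h2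
    rw [sub_eq_zero.1 h4, h2]
  · have := hgen P.2
    rwa [hP] at this

end Generation

/-! ### Powers of the inverse operator -/

section Powers

variable {H : Type*} [NormedAddCommGroup H] [InnerProductSpace ℂ H] [CompleteSpace H]

/-- The continuous functional calculus acts on an eigenvector through the value of the function
at the eigenvalue. -/
lemma cfc_apply_eigenvector {a : H →L[ℂ] H} (ha : IsSelfAdjoint a) {ν : ℝ} {e : H} (he0 : e ≠ 0)
    (he : a e = (ν : ℂ) • e) {f : ℝ → ℝ} (hf : ContinuousOn f (spectrum ℝ a)) :
    cfc f a e = (f ν : ℂ) • e := by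
  have hν : ν ∈ spectrum ℝ a := by
    rw [spectrum.mem_iff, ContinuousLinearMap.isUnit_iff_bijective]
    rintro ⟨hinj, -⟩
    refine he0 (hinj ?_)
    rw [map_zero]
    change (algebraMap ℝ (H →L[ℂ] H) ν) e - a e = 0
    rw [he, Algebra.algebraMap_eq_smul_one]
    change ν • e - (ν : ℂ) • e = 0
    rw [Complex.coe_smul, sub_self]
  have key : ∀ g : C(spectrum ℝ a, ℝ), cfcHom ha g e = (g ⟨ν, hν⟩ : ℂ) • e := by
    intro g
    induction g using ContinuousMap.induction_on_of_compact with
    | const r =>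
      have h : ContinuousMap.const (spectrum ℝ a) r =
        algebraMap ℝ C(spectrum ℝ a, ℝ) r := rfl
      rw [h, AlgHomClass.commutes, Algebra.algebraMap_eq_smul_one]
      rw [← h]
      change r • e = (r : ℂ) • e
      rw [Complex.coe_smul]
    | id => rw [cfcHom_id ha, he]; rfl
    | star_id => rw [map_star, cfcHom_id ha, ha.star_eq, he]; rfl
    | add f g hf hg =>
      rw [map_add, ContinuousMap.add_apply, Complex.ofReal_add, add_smul, ← hf, ← hg]; rfl
    | mul f g hf hg =>
      rw [map_mul, ContinuousMap.mul_apply, Complex.ofReal_mul]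
      change cfcHom ha f (cfcHom ha g e) = _
      rw [hg, map_smul, hf, smul_smul, mul_comm]
    | frequently f h =>
      refine h.mem_of_closed (isClosed_eq ?_ ?_)
      · exact (ContinuousLinearMap.apply ℂ H e).continuous.comp (cfcHom_continuous ha)
      · exact (Complex.continuous_ofReal.comp (continuous_eval_const _)).smul continuous_const
  rw [cfc_apply f a ha hf, key]
  rfl

namespace IsPlateOperator

variable {A : H →ₗ.[ℂ] H} (hA : IsPlateOperator A)

/-- The bounded operator `A ^ (-s)`, for `s ≥ 0`. -/
def invPow (s : ℝ) : H →L[ℂ] H := CFC.rpow hA.inv s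

lemma invPow_zero : hA.invPow 0 = 1 := CFC.rpow_zero hA.inv hA.inv_nonneg

lemma invPow_one : hA.invPow 1 = hA.inv := CFC.rpow_one hA.inv hA.inv_nonneg

lemma invPow_add_apply {s t : ℝ} (hs : 0 ≤ s) (ht : 0 ≤ t) (x : H) :
    hA.invPow s (hA.invPow t x) = hA.invPow (s + t) x := by
  rcases hs.eq_or_lt with rfl | hs'
  · rw [invPow_zero, zero_add, one_apply_eq_self]
  rcases ht.eq_or_lt with rfl | ht'
  · rw [invPow_zero, add_zero, one_apply_eq_self]
  lift s to ℝ≥0 using hs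
  lift t to ℝ≥0 using ht
  rw [NNReal.coe_pos] at hs' ht'
  have h1 : ∀ r : ℝ≥0, 0 < r → hA.invPow r = hA.inv ^ r := fun r hr => (CFC.nnrpow_eq_rpow hr).symm
  rw [← NNReal.coe_add, h1 _ hs', h1 _ ht', h1 _ (add_pos hs' ht'), CFC.nnrpow_add hs' ht']
  rfl

lemma invPow_inner (s : ℝ) (x y : H) : ⟪hA.invPow s x, y⟫_ℂ = ⟪x, hA.invPow s y⟫_ℂ :=
  ((ContinuousLinearMap.nonneg_iff_isPositive _).1
    (CFC.rpow_nonneg (a := hA.inv) (y := s))).isSymmetric x y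

lemma invPow_injective {s : ℝ} (hs : 0 ≤ s) : Function.Injective (hA.invPow s) := by
  rcases hs.eq_or_lt with rfl | hs'
  · rw [invPow_zero]; exact fun x y h => h
  · exact hA.rpow_inv_injective hs'

lemma mem_graph_iff_inv {x y : H} : (x, y) ∈ A.graph ↔ hA.inv y = x := by
  rw [LinearPMap.mem_graph_iff]
  constructor
  · rintro ⟨z, rfl, rfl⟩
    exact hA.inv_apply z
  · rintro rfl
    obtain ⟨h, h'⟩ := hA.inv_spec y
    exact ⟨⟨_, h⟩, rfl, h'⟩

lemma mem_pow_graph_iff {r : ℝ} (hr : 0 < r) {x y : H} :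
    (x, y) ∈ (hA.pow r).graph ↔ hA.invPow r y = x := by
  have hk : LinearMap.ker ((hA.invPow r).toLinearMap.toPMap ⊤).toFun = ⊥ := by
    rw [LinearMap.ker_eq_bot]
    intro a b hab
    exact Subtype.ext (hA.invPow_injective hr.le hab)
  have h1 : hA.pow r = ((hA.invPow r).toLinearMap.toPMap ⊤).inverse := if_neg (not_le.2 hr)
  rw [h1, LinearPMap.inverse_graph hk, Submodule.mem_map]
  constructor
  · rintro ⟨⟨p, q⟩, hpq, heq⟩
    obtain ⟨z, hz, hz'⟩ := (LinearPMap.mem_graph_iff _).1 hpq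
    cases heq
    rw [← hz', ← hz]
    rfl
  · rintro rfl
    exact ⟨(y, hA.invPow r y),
      (LinearPMap.mem_graph_iff _).2 ⟨⟨y, Submodule.mem_top⟩, rfl, rfl⟩, rfl⟩

/-- `A ^ r` maps `A ^ (-s) a` to `A ^ (r - s) a` as long as `r ≤ s`. -/
lemma mem_pow_graph_invPow_iff {r s : ℝ} (hs : 0 ≤ s) (hrs : r ≤ s) {a y : H} :
    (hA.invPow s a, y) ∈ (hA.pow r).graph ↔ hA.invPow (s - r) a = y := by
  rcases le_or_gt r 0 with hr | hr
  · have h1 : hA.pow r = (hA.invPow (-r)).toLinearMap.toPMap ⊤ := if_pos hr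
    have h2 : hA.invPow (s - r) a = hA.invPow (-r) (hA.invPow s a) := by
      rw [invPow_add_apply _ (by linarith) hs, neg_add_eq_sub]
    rw [h1, h2, LinearPMap.mem_graph_iff]
    constructor
    · rintro ⟨z, hz, hz'⟩
      exact (congrArg (hA.invPow (-r)) hz).symm.trans hz'
    · rintro rfl
      exact ⟨⟨_, Submodule.mem_top⟩, rfl, rfl⟩
  · have h2 : hA.invPow s a = hA.invPow r (hA.invPow (s - r) a) := by
      rw [invPow_add_apply _ hr.le (by linarith), add_sub_cancel]
    rw [mem_pow_graph_iff hA hr, h2, (hA.invPow_injective hr.le).eq_iff, eq_comm]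

lemma invPow_apply_eigenvector {ν : ℝ} {e : H} (he0 : e ≠ 0)
    (he : hA.inv e = (ν : ℂ) • e) {s : ℝ} (hs : 0 ≤ s) :
    hA.invPow s e = ((ν ^ s : ℝ) : ℂ) • e := by
  have h : hA.invPow s = cfc (fun x : ℝ => x ^ s) hA.inv := CFC.rpow_eq_cfc_real hA.inv_nonneg
  rw [h]
  exact cfc_apply_eigenvector hA.inv_nonneg.isSelfAdjoint he0 he
    (Real.continuous_rpow_const hs).continuousOn

lemma isCompactOperator_inv : IsCompactOperator hA.inv := by
  obtain ⟨z, R, hR, -, hR2⟩ := hA.compactResolvent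
  have h : hA.inv = R ∘L (z • hA.inv - 1) := by
    ext y
    obtain ⟨h, h'⟩ := hA.inv_spec y
    have := hR2 ⟨_, h⟩
    rw [h'] at this
    exact this.symm
  rw [h]
  exact hR.comp_clm _

/-- As `A` is unbounded and the eigenvectors of the compact operator `A⁻¹` span a dense subspace,
`A⁻¹` has arbitrarily small eigenvalues. -/
lemma exists_small_eigenvalue {ε : ℝ} (hε : 0 < ε) :
    ∃ (ν : ℝ) (e : H), 0 < ν ∧ ν < ε ∧ e ≠ 0 ∧ hA.inv e = (ν : ℂ) • e := by
  by_contra! hcon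
  have hpos : hA.inv.IsPositive := (ContinuousLinearMap.nonneg_iff_isPositive _).1 hA.inv_nonneg
  have hsymm : (hA.inv : H →ₗ[ℂ] H).IsSymmetric := hpos.isSymmetric
  have hev : ∀ (μ : ℂ) (x : H), x ≠ 0 → hA.inv x = μ • x → ε ≤ ‖μ‖ := by
    intro μ x hx0 hx
    have hμ : Module.End.HasEigenvalue (hA.inv : H →ₗ[ℂ] H) μ :=
      Module.End.hasEigenvalue_of_hasEigenvector
        (Module.End.hasEigenvector_iff.2 ⟨Module.End.mem_eigenspace_iff.2 hx, hx0⟩)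
    obtain ⟨ν, rfl⟩ : ∃ ν : ℝ, (ν : ℂ) = μ :=
      Complex.conj_eq_iff_real.1 (hsymm.conj_eigenvalue_eq_self hμ) |>.imp fun _ h => h.symm
    have h0 : 0 ≤ ν := by
      have h1 := hpos.re_inner_nonneg_left x
      have h2 : (⟪x, x⟫_ℂ).re = ‖x‖ ^ 2 := inner_self_eq_norm_sq (𝕜 := ℂ) x
      rw [hx, inner_smul_left, Complex.conj_ofReal, RCLike.re_eq_complex_re,
        Complex.re_ofReal_mul, h2] at h1
      exact nonneg_of_mul_nonneg_left h1 (by positivity)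
    have h1 : ν ≠ 0 := by
      rintro rfl
      rw [Complex.ofReal_zero, zero_smul] at hx
      exact hx0 (hA.inv_injective (hx.trans (map_zero _).symm))
    have h2 : ε ≤ ν := by
      by_contra! h2
      exact hcon ν x (lt_of_le_of_ne h0 h1.symm) h2 hx0 hx
    rw [Complex.norm_real]
    exact h2.trans (le_abs_self ν)
  -- by orthogonality `A⁻¹` is bounded below on finite sums of eigenvectors
  have hW : ∀ x ∈ (⨆ μ, Module.End.eigenspace (hA.inv : H →ₗ[ℂ] H) μ), ε * ‖x‖ ≤ ‖hA.inv x‖ := by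
    intro x hx
    obtain ⟨f, hf, rfl⟩ := (Submodule.mem_iSup_iff_exists_finsupp _ _).1 hx
    have hf' : ∀ μ, hA.inv (f μ) = μ • f μ := fun μ => Module.End.mem_eigenspace_iff.1 (hf μ)
    have ho := hsymm.orthogonalFamily_eigenspaces
    have h1 := ho.norm_sum (fun μ => ⟨f μ, hf μ⟩) f.support
    have h2 := ho.norm_sum (fun μ => ⟨μ • f μ, Submodule.smul_mem _ _ (hf μ)⟩) f.support
    simp only [Submodule.coe_subtypeₗᵢ, Submodule.subtype_apply, Submodule.coe_norm] at h1 h2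
    rw [← sq_le_sq₀ (by positivity) (norm_nonneg _), Finsupp.sum, map_sum, mul_pow, h1]
    simp only [hf']
    rw [h2, Finset.mul_sum]
    refine Finset.sum_le_sum fun μ hμ => ?_
    rw [norm_smul, mul_pow]
    gcongr
    exact hev μ (f μ) (Finsupp.mem_support_iff.1 hμ) (hf' μ)
  have hall : ∀ x, ε * ‖x‖ ≤ ‖hA.inv x‖ := by
    have hd : Dense ((⨆ μ, Module.End.eigenspace (hA.inv : H →ₗ[ℂ] H) μ : Submodule ℂ H) : Set H) :=
      Submodule.dense_iff_topologicalClosure_eq_top.2 (Submodule.topologicalClosure_eq_top_iff.2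
        (ContinuousLinearMap.orthogonalComplement_iSup_eigenspaces_eq_bot
          hA.isCompactOperator_inv hsymm))
    have hc : IsClosed {x : H | ε * ‖x‖ ≤ ‖hA.inv x‖} := isClosed_le (by fun_prop) (by fun_prop)
    intro x
    exact hc.closure_subset_iff.2 hW (hd x)
  refine hA.unbounded ⟨ε⁻¹, fun x => ?_⟩
  have h1 := hall (A x)
  rw [hA.inv_apply] at h1
  rwa [← div_eq_inv_mul, le_div_iff₀' hε]

end IsPlateOperator

end Powers

/-! ### The plate operator in coordinates -/

section Coordinates

variable {H : Type*} [NormedAddCommGroup H] [InnerProductSpace ℂ H] [CompleteSpace H]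
  {A : H →ₗ.[ℂ] H} (hA : IsPlateOperator A) {ω : ℝ} (hω : 0 < ω)

namespace IsPlateOperator

lemma invPow_half_half (x : H) : hA.invPow (1 / 2) (hA.invPow (1 / 2) x) = hA.inv x := by
  rw [hA.invPow_add_apply (by norm_num) (by norm_num), add_halves, hA.invPow_one]

lemma invPow_half_mem_domain (b : H) : hA.invPow (1 / 2) b ∈ (hA.pow (1 / 2)).domain :=
  LinearPMap.mem_domain_of_mem_graph ((hA.mem_pow_graph_iff one_half_pos (y := b)).2 rfl)

lemma pow_half_apply (b : H) :
    hA.pow (1 / 2) ⟨hA.invPow (1 / 2) b, hA.invPow_half_mem_domain b⟩ = b :=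
  LinearPMap.mem_graph_snd_inj' _ (LinearPMap.mem_graph _ _)
    ((hA.mem_pow_graph_iff one_half_pos).2 rfl) rfl

lemma invPow_half_pow_half (z : (hA.pow (1 / 2)).domain) :
    hA.invPow (1 / 2) (hA.pow (1 / 2) z) = z :=
  (hA.mem_pow_graph_iff one_half_pos).1 (LinearPMap.mem_graph _ z)

lemma inv_mem_domain (a : H) : hA.inv a ∈ A.domain := (hA.inv_spec a).choose

lemma apply_inv (a : H) : A ⟨hA.inv a, hA.inv_mem_domain a⟩ = a := (hA.inv_spec a).choose_spec

end IsPlateOperator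

namespace PhaseSpace

lemma norm_sq_eq (U : PhaseSpace hA hω) : ‖U‖ ^ 2 = ‖A (u U)‖ ^ 2 +
    (‖(v U : H)‖ ^ 2 + ω * ‖hA.pow (1 / 2) (v U)‖ ^ 2) + ‖θ U‖ ^ 2 := by
  rw [← inner_self_eq_norm_sq (𝕜 := ℂ) U, ← formH1_self_re, ← inner_self_eq_norm_sq (𝕜 := ℂ) (θ U),
    ← inner_self_eq_norm_sq (𝕜 := ℂ) (A (u U))]
  rfl

/-- The linear bijection `(u, v, θ) ↦ (A u, A ^ (1/2) v, θ)` of `H² × H¹ × H` onto `H × H × H`. -/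
def coordEquiv : PhaseSpace hA hω ≃ₗ[ℂ] H × H × H where
  toFun U := (A (u U), hA.pow (1 / 2) (v U), θ U)
  map_add' U V := by simp [LinearPMap.map_add]
  map_smul' c U := by simp [LinearPMap.map_smul]
  invFun c := (⟨hA.inv c.1, hA.inv_mem_domain c.1⟩,
    ⟨hA.invPow (1 / 2) c.2.1, hA.invPow_half_mem_domain c.2.1⟩, c.2.2)
  left_inv U := ext (Subtype.ext (hA.inv_apply _)) (Subtype.ext (hA.invPow_half_pow_half _)) rfl
  right_inv c := Prod.ext (hA.apply_inv _) (Prod.ext (hA.pow_half_apply _) rfl)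

/-- The coordinates `(a, b, h) = (A u, A ^ (1/2) v, θ)` on the phase space. -/
def coord : PhaseSpace hA hω ≃L[ℂ] H × H × H :=
  (coordEquiv hA hω).toContinuousLinearEquivOfBounds (1 + (√ω)⁻¹)
    (2 + ω + ‖hA.invPow (1 / 2)‖)
    (fun U => by
      have h := norm_sq_eq hA hω U
      have h0 : 0 ≤ ‖(v U : H)‖ ^ 2 := by positivity
      have h1 : 0 ≤ ω * ‖hA.pow (1 / 2) (v U)‖ ^ 2 := by positivity
      have e1 : ‖A (u U)‖ ≤ ‖U‖ := abs_le_of_sq_le_sq' (by nlinarith) (norm_nonneg _) |>.2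
      have e3 : ‖θ U‖ ≤ ‖U‖ := abs_le_of_sq_le_sq' (by nlinarith) (norm_nonneg _) |>.2
      have hs : 0 < √ω := Real.sqrt_pos.2 hω
      have e2 : √ω * ‖hA.pow (1 / 2) (v U)‖ ≤ ‖U‖ := by
        refine abs_le_of_sq_le_sq' ?_ (norm_nonneg _) |>.2
        rw [mul_pow, Real.sq_sqrt hω.le]
        nlinarith
      have e4 : ‖hA.pow (1 / 2) (v U)‖ ≤ (√ω)⁻¹ * ‖U‖ := by
        rwa [← div_eq_inv_mul, le_div_iff₀' hs]
      have e5 : 0 ≤ (√ω)⁻¹ * ‖U‖ := by positivity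
      have e6 := norm_nonneg U
      change max ‖A (u U)‖ (max ‖hA.pow (1 / 2) (v U)‖ ‖θ U‖) ≤ _
      rw [add_mul, one_mul]
      exact max_le (by linarith) (max_le (by linarith) (by linarith)))
    (fun c => by
      have h := norm_sq_eq hA hω ((coordEquiv hA hω).symm c)
      change _ = ‖A ⟨hA.inv c.1, _⟩‖ ^ 2 + (‖hA.invPow (1 / 2) c.2.1‖ ^ 2 +
        ω * ‖hA.pow (1 / 2) ⟨hA.invPow (1 / 2) c.2.1, _⟩‖ ^ 2) + ‖c.2.2‖ ^ 2 at h
      rw [hA.apply_inv, hA.pow_half_apply] at h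
      have e1 : ‖c.1‖ ≤ ‖c‖ := norm_fst_le c
      have e2 : ‖c.2.1‖ ≤ ‖c‖ := (norm_fst_le _).trans (norm_snd_le c)
      have e3 : ‖c.2.2‖ ≤ ‖c‖ := (norm_snd_le _).trans (norm_snd_le c)
      have e4 : ‖hA.invPow (1 / 2) c.2.1‖ ≤ ‖hA.invPow (1 / 2)‖ * ‖c‖ :=
        (hA.invPow (1 / 2)).le_opNorm_of_le e2
      refine abs_le_of_sq_le_sq' (h.le.trans ?_) (by positivity) |>.2
      calc _ ≤ ‖c‖ ^ 2 + ((‖hA.invPow (1 / 2)‖ * ‖c‖) ^ 2 + ω * ‖c‖ ^ 2) + ‖c‖ ^ 2 := by gcongr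
        _ = (2 + ω + ‖hA.invPow (1 / 2)‖ ^ 2) * ‖c‖ ^ 2 := by ring
        _ ≤ ((2 + ω + ‖hA.invPow (1 / 2)‖) * ‖c‖) ^ 2 := by
          rw [mul_pow]
          gcongr
          nlinarith [mul_nonneg hω.le (norm_nonneg (hA.invPow (1 / 2))),
            norm_nonneg (hA.invPow (1 / 2))])

instance : CompleteSpace (PhaseSpace hA hω) :=
  (completeSpace_congr (e := (coord hA hω).toEquiv) (coord hA hω).isUniformEmbedding).2
    inferInstance

variable {hA hω}

lemma coord_u (U : PhaseSpace hA hω) : hA.inv (coord hA hω U).1 = u U := hA.inv_apply _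

lemma coord_v (U : PhaseSpace hA hω) : hA.invPow (1 / 2) (coord hA hω U).2.1 = v U :=
  hA.invPow_half_pow_half _

lemma coord_θ (U : PhaseSpace hA hω) : (coord hA hω U).2.2 = θ U := rfl

lemma inner_eq_coord (U V : PhaseSpace hA hω) :
    ⟪U, V⟫_ℂ = ⟪(coord hA hω U).1, (coord hA hω V).1⟫_ℂ +
      (⟪hA.invPow (1 / 2) (coord hA hω U).2.1, hA.invPow (1 / 2) (coord hA hω V).2.1⟫_ℂ +
        (ω : ℂ) * ⟪(coord hA hω U).2.1, (coord hA hω V).2.1⟫_ℂ) +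
      ⟪(coord hA hω U).2.2, (coord hA hω V).2.2⟫_ℂ := by
  rw [coord_v, coord_v]
  rfl

end PhaseSpace

/-- The inverse of the plate operator in the coordinates `(A u, A ^ (1/2) v, θ)`. -/
def plateInvCoord (ω σ : ℝ) : H × H × H →L[ℂ] H × H × H :=
  let a := ContinuousLinearMap.fst ℂ H (H × H)
  let b := ContinuousLinearMap.fst ℂ H H ∘L ContinuousLinearMap.snd ℂ H (H × H)
  let h := ContinuousLinearMap.snd ℂ H H ∘L ContinuousLinearMap.snd ℂ H (H × H)
  (-(hA.invPow (3 - 2 * σ) ∘L a) - hA.invPow (2 - σ) ∘L h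
      - hA.invPow (1 / 2) ∘L (hA.inv + (ω : ℂ) • 1) ∘L b).prod
    ((hA.invPow (1 / 2) ∘L a).prod (-(hA.invPow (2 - σ) ∘L a) - hA.inv ∘L h))

lemma plateInvCoord_apply (σ : ℝ) (a b h : H) : plateInvCoord hA ω σ (a, b, h) =
    (-hA.invPow (3 - 2 * σ) a - hA.invPow (2 - σ) h - hA.invPow (1 / 2) (hA.inv b + (ω : ℂ) • b),
      hA.invPow (1 / 2) a, -hA.invPow (2 - σ) a - hA.inv h) := rfl

/-- The inverse of the plate operator. -/
def plateInv (σ : ℝ) : PhaseSpace hA hω →L[ℂ] PhaseSpace hA hω :=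
  (PhaseSpace.coord hA hω).symm.toContinuousLinearMap ∘L plateInvCoord hA ω σ ∘L
    (PhaseSpace.coord hA hω).toContinuousLinearMap

lemma coord_plateInv (σ : ℝ) (U : PhaseSpace hA hω) :
    PhaseSpace.coord hA hω (plateInv hA hω σ U) =
      plateInvCoord hA ω σ (PhaseSpace.coord hA hω U) :=
  (PhaseSpace.coord hA hω).apply_symm_apply _

variable {σ : ℝ}

open PhaseSpace in
/-- `plateInv` is the inverse of the plate operator. The restriction on `σ` makes the exponent
`3 - 2σ` nonnegative. -/
lemma mem_plateGraph_iff (hσ : σ < 5 / 4) {P : PhaseSpace hA hω × PhaseSpace hA hω} :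
    P ∈ plateGraph hA hω σ ↔ plateInv hA hω σ P.2 = P.1 := by
  obtain ⟨U, V⟩ := P
  rw [← (coord hA hω).injective.eq_iff, coord_plateInv]
  have hu := coord_u U
  have hv := coord_v U
  have hθ := coord_θ U
  have hu' := coord_u V
  have hv' := coord_v V
  have hθ' := coord_θ V
  change (((u V : A.domain) : H) = (v U : (hA.pow (1 / 2)).domain) ∧
    (∃ p m : H, (θ U, p) ∈ (hA.pow (σ - 2)).graph ∧
      (-((u U : A.domain) : H) + p, m) ∈ (hA.pow (3 / 2)).graph ∧
      ∀ z : (hA.pow (1 / 2)).domain, formH1 hA ω z (v V) = ⟪hA.pow (1 / 2) z, m⟫_ℂ) ∧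
    ∃ q : H, (((v U : (hA.pow (1 / 2)).domain) : H), q) ∈ (hA.pow (σ - 1)).graph ∧
      (-θ U - q, θ V) ∈ A.graph) ↔ _
  have hform : ∀ m : H, (∀ z : (hA.pow (1 / 2)).domain,
      formH1 hA ω z (v V) = ⟪hA.pow (1 / 2) z, m⟫_ℂ) ↔
      m = hA.inv (coord hA hω V).2.1 + (ω : ℂ) • (coord hA hω V).2.1 := by
    intro m
    have hb : hA.pow (1 / 2) (v V) = (coord hA hω V).2.1 := rfl
    have key : ∀ z : (hA.pow (1 / 2)).domain, formH1 hA ω z (v V) =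
        ⟪hA.pow (1 / 2) z, hA.inv (coord hA hω V).2.1 + (ω : ℂ) • (coord hA hω V).2.1⟫_ℂ := by
      intro z
      rw [formH1, ← hv', hb, ← hA.invPow_half_pow_half z, hA.invPow_inner,
        hA.invPow_half_half, inner_add_right, inner_smul_right]
    constructor
    · intro h
      refine ext_inner_left ℂ fun c => ?_
      have h1 := h ⟨_, hA.invPow_half_mem_domain c⟩
      rw [key, hA.pow_half_apply] at h1
      exact h1.symm
    · rintro rfl
      exact key
  rw [← hu, ← hv, ← hθ, ← hu', ← hθ']
  simp only [hform]
  generalize coord hA hω U = c at *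
  generalize coord hA hω V = d at *
  obtain ⟨a, b, h⟩ := c
  obtain ⟨a', b', h'⟩ := d
  simp only [plateInvCoord_apply, Prod.mk.injEq]
  have hb : hA.inv a' = hA.invPow (1 / 2) b ↔ hA.invPow (1 / 2) a' = b := by
    rw [← hA.invPow_half_half, (hA.invPow_injective (by norm_num)).eq_iff]
  have hp : ∀ p, (h, p) ∈ (hA.pow (σ - 2)).graph ↔ hA.invPow (2 - σ) h = p := by
    intro p
    have h1 := hA.mem_pow_graph_invPow_iff (r := σ - 2) le_rfl (by linarith) (a := h) (y := p)
    rwa [hA.invPow_zero, one_apply_eq_self, zero_sub, neg_sub] at h1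
  have hq : ∀ q, (hA.invPow (1 / 2) (hA.invPow (1 / 2) a'), q) ∈ (hA.pow (σ - 1)).graph ↔
      hA.invPow (2 - σ) a' = q := by
    intro q
    rw [hA.invPow_half_half, ← hA.invPow_one,
      hA.mem_pow_graph_invPow_iff zero_le_one (by linarith)]
    ring_nf
  have hid : ∀ m, hA.invPow (2 - σ) (-hA.invPow (2 - σ) a' - hA.inv h') - hA.invPow (3 / 2) m =
      hA.inv (-hA.invPow (3 - 2 * σ) a' - hA.invPow (2 - σ) h' - hA.invPow (1 / 2) m) := by
    intro m
    have e0 : (0 : ℝ) ≤ 2 - σ := by linarith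
    have e1 : (0 : ℝ) ≤ 3 - 2 * σ := by linarith
    rw [← hA.invPow_one]
    simp only [map_sub, map_neg]
    rw [hA.invPow_add_apply e0 e0, hA.invPow_add_apply e0 zero_le_one,
      hA.invPow_add_apply zero_le_one e1, hA.invPow_add_apply zero_le_one e0,
      hA.invPow_add_apply zero_le_one (by norm_num)]
    ring_nf
  simp only [hp, hA.mem_pow_graph_iff (show (0 : ℝ) < 3 / 2 by norm_num), hA.mem_graph_iff_inv, hb]
  constructor
  · rintro ⟨rfl, ⟨p, m, rfl, h1, rfl⟩, q, h2, h3⟩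
    rw [hq] at h2
    subst h2
    have h4 : -hA.invPow (2 - σ) a' - hA.inv h' = h := by rw [h3]; abel
    refine ⟨hA.inv_injective ?_, rfl, h4⟩
    rw [← hid, h4, h1]
    abel
  · rintro ⟨rfl, rfl, rfl⟩
    refine ⟨rfl, ⟨_, _, rfl, ?_, rfl⟩, _, (hq _).2 rfl, by abel⟩
    rw [← hid]
    abel

/-- The inverse of the plate operator is dissipative: in coordinates the real part of the form is
`-‖A ^ (σ - 3/2) a + A ^ (-1/2) h‖ ^ 2`. -/
lemma re_inner_plateInv_nonpos (hσ : σ < 5 / 4) (U : PhaseSpace hA hω) :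
    (⟪plateInv hA hω σ U, U⟫_ℂ).re ≤ 0 := by
  rw [PhaseSpace.inner_eq_coord, coord_plateInv]
  obtain ⟨a, b, h⟩ := PhaseSpace.coord hA hω U
  rw [plateInvCoord_apply]
  have e0 : (0 : ℝ) ≤ 3 / 2 - σ := by linarith
  have e1 : (0 : ℝ) ≤ 1 / 2 := by norm_num
  have f1 : ⟪hA.invPow (3 - 2 * σ) a, a⟫_ℂ =
      ⟪hA.invPow (3 / 2 - σ) a, hA.invPow (3 / 2 - σ) a⟫_ℂ := by
    rw [← hA.invPow_inner, hA.invPow_add_apply e0 e0]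
    ring_nf
  have f2 : ⟪hA.invPow (2 - σ) h, a⟫_ℂ =
      ⟪hA.invPow (1 / 2) h, hA.invPow (3 / 2 - σ) a⟫_ℂ := by
    rw [← hA.invPow_inner, hA.invPow_add_apply e0 e1]
    ring_nf
  have f3 : ⟪hA.invPow (2 - σ) a, h⟫_ℂ =
      ⟪hA.invPow (3 / 2 - σ) a, hA.invPow (1 / 2) h⟫_ℂ := by
    rw [← hA.invPow_inner, hA.invPow_add_apply e1 e0]
    ring_nf
  have f4 : ⟪hA.inv h, h⟫_ℂ = ⟪hA.invPow (1 / 2) h, hA.invPow (1 / 2) h⟫_ℂ := by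
    rw [← hA.invPow_inner, hA.invPow_half_half]
  have f5 : ⟪hA.invPow (1 / 2) (hA.inv b + (ω : ℂ) • b), a⟫_ℂ =
      ⟪hA.inv b, hA.invPow (1 / 2) a⟫_ℂ + (ω : ℂ) * ⟪b, hA.invPow (1 / 2) a⟫_ℂ := by
    rw [hA.invPow_inner, inner_add_left, inner_smul_left, Complex.conj_ofReal]
  have f6 : ⟪hA.invPow (1 / 2) (hA.invPow (1 / 2) a), hA.invPow (1 / 2) b⟫_ℂ =
      ⟪hA.invPow (1 / 2) a, hA.inv b⟫_ℂ := by
    rw [hA.invPow_inner, hA.invPow_half_half]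
  have g1 : (⟪hA.inv b, hA.invPow (1 / 2) a⟫_ℂ).re = (⟪hA.invPow (1 / 2) a, hA.inv b⟫_ℂ).re :=
    inner_re_symm (𝕜 := ℂ) _ _
  have g2 : (⟪b, hA.invPow (1 / 2) a⟫_ℂ).re = (⟪hA.invPow (1 / 2) a, b⟫_ℂ).re :=
    inner_re_symm (𝕜 := ℂ) _ _
  have g3 : 0 ≤ (⟪hA.invPow (3 / 2 - σ) a + hA.invPow (1 / 2) h,
      hA.invPow (3 / 2 - σ) a + hA.invPow (1 / 2) h⟫_ℂ).re := inner_self_nonneg (𝕜 := ℂ)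
  simp only [inner_add_left, inner_add_right, Complex.add_re] at g3
  simp only [inner_sub_left, inner_neg_left, f1, f2, f3, f4, f5, f6, Complex.add_re,
    Complex.sub_re, Complex.neg_re, Complex.re_ofReal_mul, g1, g2]
  linarith

end Coordinates

/-! ### Roots of the characteristic polynomial -/

section Roots

open Polynomial in
/-- A cubic polynomial has a root close to any point where it is small compared with its
derivative, because the logarithmic derivative is the sum of `1 / (z₀ - r)` over the roots `r`. -/
lemma exists_root_near {p : ℂ[X]} (hp : p.natDegree ≤ 3) {z₀ : ℂ} {η : ℝ} (hη : 0 < η)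
    (h : 3 * ‖p.eval z₀‖ < η * ‖p.derivative.eval z₀‖) : ∃ z, p.eval z = 0 ∧ ‖z - z₀‖ < η := by
  by_cases h0 : p.eval z₀ = 0
  · exact ⟨z₀, h0, by simpa using hη⟩
  by_contra! hcon
  have hp0 : p ≠ 0 := by rintro rfl; simp at h0
  have hs := (IsAlgClosed.splits p).eval_derivative_div_eval_of_ne_zero h0
  have h1 : ‖(p.roots.map fun z => 1 / (z₀ - z)).sum‖ ≤ 3 * η⁻¹ := by
    have h2 : ‖(p.roots.map fun z => 1 / (z₀ - z)).sum‖ ≤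
        ((p.roots.map fun z => 1 / (z₀ - z)).map (‖·‖)).sum := norm_multiset_sum_le _
    have h3 := Multiset.sum_le_card_nsmul ((p.roots.map fun z => 1 / (z₀ - z)).map (‖·‖)) η⁻¹ (by
      intro x hx
      obtain ⟨y, hy, rfl⟩ := Multiset.mem_map.1 hx
      obtain ⟨r, hr, rfl⟩ := Multiset.mem_map.1 hy
      rw [norm_div, norm_one, one_div, norm_sub_rev]
      exact inv_anti₀ hη (hcon r ((mem_roots hp0).1 hr)))
    refine h2.trans (h3.trans ?_)
    rw [Multiset.card_map, Multiset.card_map, nsmul_eq_mul]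
    gcongr
    exact_mod_cast (card_roots' p).trans hp
  have hpos : 0 < ‖p.eval z₀‖ := norm_pos_iff.2 h0
  rw [← hs, norm_div, div_le_iff₀ hpos, mul_right_comm, ← div_eq_mul_inv, le_div_iff₀ hη] at h1
  linarith

/-- After the rescaling `λ = ν ^ (-1/2) z`, the characteristic equation of the plate operator on
the eigenspace of `A⁻¹` for the eigenvalue `ν` tends to `1 + ω z ^ 2 = 0` as `ν → 0`, so it has a
root close to `i / √ω`. The hypothesis on `σ` makes the coupling coefficient `ν ^ (5/2 - 2σ)`
vanish in the limit. -/
lemma eventually_exists_root {ω σ : ℝ} (hω : 0 < ω) (hσ : σ < 5 / 4) {η : ℝ} (hη : 0 < η) :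
    ∀ᶠ ν : ℝ in 𝓝 0, ∃ z : ℂ, (1 + ((√ν : ℝ) : ℂ) * z) * (1 + ((ν : ℂ) + ω) * z ^ 2) +
      ((ν ^ (5 / 2 - 2 * σ) : ℝ) : ℂ) * z = 0 ∧ ‖z - Complex.I / (√ω : ℝ)‖ < η := by
  let z₀ : ℂ := Complex.I / (√ω : ℝ)
  have hz₀ : (ω : ℂ) * z₀ ^ 2 = -1 := by
    have h1 : (((√ω : ℝ) : ℂ)) ^ 2 = ω := by
      rw [← Complex.ofReal_pow, Real.sq_sqrt hω.le]
    have h2 : (ω : ℂ) ≠ 0 := by exact_mod_cast hω.ne'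
    rw [div_pow, h1, Complex.I_sq]
    field_simp
  have hz₀' : z₀ ≠ 0 := by
    intro h
    rw [h] at hz₀
    norm_num at hz₀
  let F : ℝ → ℂ := fun ν => (1 + ((√ν : ℝ) : ℂ) * z₀) * (1 + ((ν : ℂ) + ω) * z₀ ^ 2) +
      ((ν ^ (5 / 2 - 2 * σ) : ℝ) : ℂ) * z₀
  let G : ℝ → ℂ := fun ν => ((√ν : ℝ) : ℂ) * (1 + ((ν : ℂ) + ω) * z₀ ^ 2) +
      (1 + ((√ν : ℝ) : ℂ) * z₀) * (((ν : ℂ) + ω) * (2 * z₀)) + ((ν ^ (5 / 2 - 2 * σ) : ℝ) : ℂ)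
  have hκ : Continuous fun ν : ℝ => ν ^ (5 / 2 - 2 * σ) :=
    Real.continuous_rpow_const (by linarith)
  have hκ0 : (0 : ℝ) ^ (5 / 2 - 2 * σ) = 0 := Real.zero_rpow (by linarith)
  have hF : Continuous F := by fun_prop
  have hG : Continuous G := by fun_prop
  have hlim : Tendsto (fun ν => 3 * ‖F ν‖ - η * ‖G ν‖) (𝓝 0) (𝓝 (3 * ‖F 0‖ - η * ‖G 0‖)) :=
    Continuous.tendsto (by fun_prop) 0
  have hF0 : F 0 = 0 := by simp [F, hκ0, hz₀]
  have hG0 : G 0 = ω * (2 * z₀) := by simp [G, hκ0]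
  have hG0' : 0 < η * ‖G 0‖ := by
    have h2 : (ω : ℂ) ≠ 0 := by exact_mod_cast hω.ne'
    rw [hG0]
    exact mul_pos hη (norm_pos_iff.2 (mul_ne_zero h2 (mul_ne_zero two_ne_zero hz₀')))
  have hev := hlim.eventually_lt_const (show 3 * ‖F 0‖ - η * ‖G 0‖ < 0 by
    rw [hF0, norm_zero]; linarith)
  filter_upwards [hev] with ν hν
  let p : Polynomial ℂ := (1 + .C ((√ν : ℝ) : ℂ) * .X) * (1 + .C ((ν : ℂ) + ω) * .X ^ 2) +
    .C ((ν ^ (5 / 2 - 2 * σ) : ℝ) : ℂ) * .X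
  have hp : p.natDegree ≤ 3 := by
    simp only [p]
    compute_degree
  have hpF : p.eval z₀ = F ν := by simp [p, F]
  have hpG : p.derivative.eval z₀ = G ν := by
    simp [p, G, one_add_one_eq_two]
  obtain ⟨z, hz, hz'⟩ := exists_root_near hp hη (z₀ := z₀) (by rw [hpF, hpG]; linarith)
  exact ⟨z, by simpa [p] using hz, hz'⟩

end Roots

/-! ### Eigenvalues of the plate operator -/

section Eigenvalues

variable {H : Type*} [NormedAddCommGroup H] [InnerProductSpace ℂ H] [CompleteSpace H]
  {A : H →ₗ.[ℂ] H} (hA : IsPlateOperator A) {ω : ℝ} (hω : 0 < ω) {σ : ℝ}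

/-- A root of the rescaled characteristic equation yields an eigenvector of the plate operator. -/
lemma exists_plate_eigenvector (hσ : σ < 5 / 4) {ν : ℝ} (hν : 0 < ν) {e : H} (he0 : e ≠ 0)
    (he : hA.inv e = (ν : ℂ) • e) {z : ℂ}
    (hz : (1 + ((√ν : ℝ) : ℂ) * z) * (1 + ((ν : ℂ) + ω) * z ^ 2) +
      ((ν ^ (5 / 2 - 2 * σ) : ℝ) : ℂ) * z = 0) :
    ∃ U : PhaseSpace hA hω, U ≠ 0 ∧ (U, (z / (√ν : ℝ)) • U) ∈ plateGraph hA hω σ := by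
  -- `s`, `x` and `y` stand for `ν ^ (1/2)`, `ν ^ (2 - σ)` and `ν ^ (3 - 2σ)`
  set s : ℂ := ((√ν : ℝ) : ℂ) with hs
  set x : ℂ := ((ν ^ (2 - σ) : ℝ) : ℂ) with hx
  set y : ℂ := ((ν ^ (3 - 2 * σ) : ℝ) : ℂ) with hy
  set k : ℂ := ((ν ^ (5 / 2 - 2 * σ) : ℝ) : ℂ) with hk
  have hs0 : s ≠ 0 := by
    rw [hs]
    exact_mod_cast (Real.sqrt_pos.2 hν).ne'
  have hss : s ^ 2 = ν := by rw [hs, ← Complex.ofReal_pow, Real.sq_sqrt hν.le]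
  have hks : k * s = y := by
    rw [hk, hs, hy, ← Complex.ofReal_mul, Real.sqrt_eq_rpow, ← Real.rpow_add hν]
    ring_nf
  have hxx : x ^ 2 = s ^ 2 * y := by
    rw [hss, hx, hy, ← Complex.ofReal_pow, ← Complex.ofReal_mul, ← Real.rpow_natCast,
      ← Real.rpow_mul hν.le]
    have h : ν * ν ^ (3 - 2 * σ) = ν ^ (1 + (3 - 2 * σ)) := by
      rw [Real.rpow_add hν, Real.rpow_one]
    rw [h]
    push_cast
    ring_nf
  have hk0 : k ≠ 0 := by
    rw [hk]
    exact_mod_cast (Real.rpow_pos_of_pos hν _).ne'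
  have hz0 : z ≠ 0 := by
    rintro rfl
    norm_num at hz
  have hsz : 1 + s * z ≠ 0 := by
    intro h
    rw [h, zero_mul, zero_add] at hz
    exact (mul_ne_zero hk0 hz0) hz
  have e1 : hA.invPow (3 - 2 * σ) e = y • e :=
    hA.invPow_apply_eigenvector he0 he (by linarith)
  have e2 : hA.invPow (2 - σ) e = x • e := hA.invPow_apply_eigenvector he0 he (by linarith)
  have e3 : hA.invPow (1 / 2) e = s • e := by
    rw [hs, Real.sqrt_eq_rpow]
    exact hA.invPow_apply_eigenvector he0 he (by norm_num)
  refine ⟨(PhaseSpace.coord hA hω).symm (e, z • e, (-(z * x / (s * (1 + s * z)))) • e), ?_, ?_⟩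
  · intro h
    have h1 := congrArg (PhaseSpace.coord hA hω) h
    rw [ContinuousLinearEquiv.apply_symm_apply, map_zero] at h1
    exact he0 (congrArg Prod.fst h1)
  · rw [mem_plateGraph_iff hA hω hσ, ← (PhaseSpace.coord hA hω).injective.eq_iff, coord_plateInv]
    simp only [map_smul, ContinuousLinearEquiv.apply_symm_apply]
    rw [plateInvCoord_apply]
    simp only [map_smul, map_add, he, e1, e2, e3, Prod.smul_mk, Prod.mk.injEq, ← hss]
    rw [← hss] at hz
    rw [mul_comm s z] at hsz
    refine ⟨?_, ?_, ?_⟩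
    · match_scalars
      field_simp
      linear_combination -s ^ 2 * hz + z ^ 2 * hxx + z * s * hks
    · match_scalars
      field_simp
    · match_scalars
      field_simp
      ring

end Eigenvalues

/-! ### Analytic semigroups and eigenvectors -/

section Analytic

/-- A convex open cone inside the sector of half-angle `δ`. -/
lemma cone_subset_sector {δ : ℝ} (hδ : 0 < δ) (hδ' : δ ≤ Real.pi / 2) :
    {z : ℂ | |z.im| < Real.tan (δ / 2) * z.re} ⊆ sector δ := by
  intro z hz
  have hk : 0 < Real.tan (δ / 2) :=
    Real.tan_pos_of_pos_of_lt_pi_div_two (by linarith) (by linarith [Real.pi_pos])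
  have hz' : |z.im| < Real.tan (δ / 2) * z.re := hz
  have hre : 0 < z.re := (mul_pos_iff_of_pos_left hk).1 ((abs_nonneg _).trans_lt hz')
  have h0 : z ≠ 0 := by rintro rfl; simp at hre
  have harg := abs_lt.1 (Complex.abs_arg_lt_pi_div_two_iff.2 (Or.inl hre))
  have h1 : z.arg = Real.arctan (z.im / z.re) := by
    rw [← Complex.tan_arg, Real.arctan_tan harg.1 harg.2]
  have h2 : Real.arctan (Real.tan (δ / 2)) = δ / 2 :=
    Real.arctan_tan (by linarith [Real.pi_pos]) (by linarith [Real.pi_pos])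
  obtain ⟨h3, h4⟩ := abs_lt.1 hz'
  refine ⟨h0, lt_of_lt_of_le (b := δ / 2) ?_ (by linarith)⟩
  rw [h1, ← h2, abs_lt, ← Real.arctan_neg]
  constructor
  · apply Real.arctan_strictMono
    rw [lt_div_iff₀ hre]
    linarith
  · apply Real.arctan_strictMono
    rwa [div_lt_iff₀ hre]

variable {X : Type*} [NormedAddCommGroup X] [NormedSpace ℂ X]

/-- An eigenvector of the generator is an eigenvector of a holomorphic extension `T` of the
semigroup: `e ^ (-μ z) T(z) x` has zero derivative on the cone, as the complex derivative of
`T(z) x` can be computed along positive real increments. -/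
lemma extension_apply_eigenvector {S : ℝ≥0 → X →L[ℂ] X} {T : ℂ → X →L[ℂ] X} {δ : ℝ}
    (hδ : 0 < δ) (hδ' : δ ≤ Real.pi / 2) (hTS : ∀ t : ℝ≥0, T ((t : ℝ) : ℂ) = S t)
    (hT : DifferentiableOn ℂ T (sector δ))
    (hadd : ∀ z ∈ sector δ, ∀ w ∈ sector δ, T (z + w) = (T z).comp (T w))
    (hlim : ∀ x : X, Tendsto (fun z => T z x) (𝓝[sector δ] 0) (𝓝 x))
    {x : X} {μ : ℂ} (hx : (x, μ • x) ∈ generatorGraph S) {z : ℂ}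
    (hz : |z.im| < Real.tan (δ / 2) * z.re) : T z x = Complex.exp (μ * z) • x := by
  set K : Set ℂ := {z : ℂ | |z.im| < Real.tan (δ / 2) * z.re} with hK
  have hsub : K ⊆ sector δ := cone_subset_sector hδ hδ'
  have hk : 0 < Real.tan (δ / 2) :=
    Real.tan_pos_of_pos_of_lt_pi_div_two (by linarith) (by linarith [Real.pi_pos])
  have hopen : IsOpen K := isOpen_lt (by fun_prop) (by fun_prop)
  have hconv : Convex ℝ K := by
    intro a ha b hb s t hs ht hst
    have ha' : |a.im| < Real.tan (δ / 2) * a.re := ha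
    have hb' : |b.im| < Real.tan (δ / 2) * b.re := hb
    change |(s • a + t • b).im| < Real.tan (δ / 2) * (s • a + t • b).re
    simp only [Complex.add_im, Complex.smul_im, Complex.add_re, Complex.smul_re, smul_eq_mul]
    have h1 : |s * a.im + t * b.im| ≤ s * |a.im| + t * |b.im| := by
      refine (abs_add_le _ _).trans (le_of_eq ?_)
      rw [abs_mul, abs_mul, abs_of_nonneg hs, abs_of_nonneg ht]
    refine h1.trans_lt ?_
    rcases hs.eq_or_lt with rfl | hs'
    · have : t = 1 := by linarith
      subst this
      linarith
    · nlinarith [mul_lt_mul_of_pos_left ha' hs', mul_le_mul_of_nonneg_left hb'.le ht]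
  have hreal : ∀ h : ℝ, 0 < h → (h : ℂ) ∈ K := by
    intro h hh
    change |((h : ℂ)).im| < Real.tan (δ / 2) * ((h : ℂ)).re
    rw [Complex.ofReal_im, Complex.ofReal_re, abs_zero]
    positivity
  -- the derivative of `T z x`
  have hderiv : ∀ w ∈ K, HasDerivAt (fun z => T z x) (μ • T w x) w := by
    intro w hw
    have hd : DifferentiableAt ℂ (fun z => T z x) w := by
      have h1 : DifferentiableAt ℂ T w :=
        (hT w (hsub hw)).differentiableAt (mem_of_superset (hopen.mem_nhds hw) hsub)
      exact h1.clm_apply (differentiableAt_const x)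
    have hd' := hd.hasDerivAt
    have hslope : Tendsto (fun t : ℝ≥0 => ((t : ℝ) : ℂ)⁻¹ • (T (w + ((t : ℝ) : ℂ)) x - T w x))
        (𝓝[>] (0 : ℝ≥0)) (𝓝 (deriv (fun z => T z x) w)) := by
      have h1 : Tendsto (fun t : ℝ≥0 => ((t : ℝ) : ℂ)) (𝓝[>] (0 : ℝ≥0)) (𝓝[≠] (0 : ℂ)) := by
        refine tendsto_nhdsWithin_of_tendsto_nhds_of_eventually_within _ ?_ ?_
        · have := (Complex.continuous_ofReal.comp NNReal.continuous_coe).tendsto (0 : ℝ≥0)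
          simp only [Function.comp_apply, NNReal.coe_zero, Complex.ofReal_zero] at this
          exact this.mono_left nhdsWithin_le_nhds
        · filter_upwards [self_mem_nhdsWithin] with t ht
          have ht' : (0 : ℝ) < t := NNReal.coe_pos.2 ht
          exact Complex.ofReal_ne_zero.2 ht'.ne'
      exact hd'.tendsto_slope_zero.comp h1
    have hgen : Tendsto (fun t : ℝ≥0 => ((t : ℝ) : ℂ)⁻¹ • (S t x - x)) (𝓝[>] (0 : ℝ≥0))
        (𝓝 (μ • x)) := hx
    have hgen' := (T w).continuous.tendsto _ |>.comp hgen
    have heq : deriv (fun z => T z x) w = T w (μ • x) := by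
      refine tendsto_nhds_unique hslope (hgen'.congr' ?_)
      filter_upwards [self_mem_nhdsWithin] with t ht
      have ht' : (0 : ℝ) < t := NNReal.coe_pos.2 ht
      rw [hadd w (hsub hw) _ (hsub (hreal t ht')), hTS]
      simp
    rwa [heq, map_smul] at hd'
  have hg : ∀ w ∈ K, HasDerivAt (fun z => Complex.exp (-(μ * z)) • T z x) 0 w := by
    intro w hw
    have h1 : HasDerivAt (fun z => Complex.exp (-(μ * z))) (Complex.exp (-(μ * w)) * -(μ * 1)) w :=
      ((hasDerivAt_id w).const_mul μ).neg.cexp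
    refine (h1.smul (hderiv w hw)).congr_deriv ?_
    rw [smul_smul, ← add_smul]
    simp
  have hconst : ∀ w ∈ K, Complex.exp (-(μ * w)) • T w x = Complex.exp (-(μ * z)) • T z x := by
    intro w hw
    have h1 := hconv.norm_image_sub_le_of_norm_hasDerivWithin_le (C := 0)
      (fun w hw => (hg w hw).hasDerivWithinAt) (fun w _ => by simp) hz hw
    rw [zero_mul] at h1
    exact sub_eq_zero.1 (norm_le_zero_iff.1 h1)
  -- the constant is found by letting `w → 0` along the positive reals
  have hval : Complex.exp (-(μ * z)) • T z x = x := by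
    have h1 : Tendsto (fun t : ℝ => (t : ℂ)) (𝓝[>] (0 : ℝ)) (𝓝[sector δ] (0 : ℂ)) := by
      refine tendsto_nhdsWithin_of_tendsto_nhds_of_eventually_within _ ?_ ?_
      · have := Complex.continuous_ofReal.tendsto (0 : ℝ)
        rw [Complex.ofReal_zero] at this
        exact this.mono_left nhdsWithin_le_nhds
      · filter_upwards [self_mem_nhdsWithin] with t ht using hsub (hreal t ht)
    have h2 : Tendsto (fun w : ℂ => Complex.exp (-(μ * w))) (𝓝[sector δ] 0) (𝓝 1) := by
      have : Tendsto (fun w : ℂ => Complex.exp (-(μ * w))) (𝓝 0) (𝓝 (Complex.exp (-(μ * 0)))) :=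
        Continuous.tendsto (by fun_prop) 0
      rw [mul_zero, neg_zero, Complex.exp_zero] at this
      exact this.mono_left nhdsWithin_le_nhds
    have h3 := (h2.smul (hlim x)).comp h1
    rw [one_smul] at h3
    refine tendsto_nhds_unique (tendsto_const_nhds.congr' ?_) h3
    filter_upwards [self_mem_nhdsWithin] with t ht
    exact (hconst t (hreal t ht)).symm
  rw [Complex.exp_neg] at hval
  rw [← hval, smul_smul, mul_inv_cancel₀ (Complex.exp_ne_zero _), one_smul, hval]

/-- If the generator of a semigroup has eigenvalues of arbitrarily large modulus which approach
the direction of the positive imaginary axis, the semigroup is not analytic. -/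
lemma not_isAnalyticSemigroup {S : ℝ≥0 → X →L[ℂ] X}
    (h : ∀ k : ℝ, 0 < k → ∀ M : ℝ, ∃ (μ : ℂ) (x : X), x ≠ 0 ∧ (x, μ • x) ∈ generatorGraph S ∧
      M < μ.re + k * μ.im) : ¬ IsAnalyticSemigroup S := by
  rintro ⟨δ, hδ, hδ', T, hTS, hT, hadd, hlim⟩
  have hk : 0 < Real.tan (δ / 2) :=
    Real.tan_pos_of_pos_of_lt_pi_div_two (by linarith) (by linarith [Real.pi_pos])
  -- on the ray through `ζ` the eigenvalues `e ^ (μ ζ)` of the bounded operator `T ζ` blow up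
  let ζ : ℂ := ⟨1, -(Real.tan (δ / 2) / 2)⟩
  have hζ : |ζ.im| < Real.tan (δ / 2) * ζ.re := by
    change |-(Real.tan (δ / 2) / 2)| < Real.tan (δ / 2) * 1
    rw [abs_neg, abs_of_pos (by positivity)]
    linarith
  obtain ⟨μ, x, hx0, hx, hμ⟩ := h (Real.tan (δ / 2) / 2) (by positivity) ‖T ζ‖
  have h1 := (T ζ).le_opNorm x
  rw [extension_apply_eigenvector hδ hδ' hTS hT hadd hlim hx hζ, norm_smul,
    Complex.norm_exp] at h1
  have h2 := le_of_mul_le_mul_right h1 (norm_pos_iff.2 hx0)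
  have h3 : (μ * ζ).re = μ.re + Real.tan (δ / 2) / 2 * μ.im := by
    simp only [Complex.mul_re, ζ]
    ring
  rw [h3] at h2
  have h4 := Real.add_one_le_exp (μ.re + Real.tan (δ / 2) / 2 * μ.im)
  linarith

end Analytic

end

theorem theorem14 {H : Type*} [NormedAddCommGroup H] [InnerProductSpace ℂ H] [CompleteSpace H]
    {A : H →ₗ.[ℂ] H} (hA : IsPlateOperator A) {ω : ℝ} (hω : 0 < ω) {σ : ℝ} (hσ0 : 0 ≤ σ)
    (hσ1 : σ < 5 / 4) :
    (∃ S : ℝ≥0 → PhaseSpace hA hω →L[ℂ] PhaseSpace hA hω,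
      IsC0Semigroup S ∧ (∀ t, ‖S t‖ ≤ 1) ∧ generator S = plateOperator hA hω σ) ∧
    ∀ S : ℝ≥0 → PhaseSpace hA hω →L[ℂ] PhaseSpace hA hω,
      IsC0Semigroup S → generator S = plateOperator hA hω σ → ¬ IsAnalyticSemigroup S := by
  constructor
  · have hinj : Function.Injective (plateInv hA hω σ) := by
      refine (injective_iff_map_eq_zero _).2 fun V hV => ?_
      exact plateGraph_functional hA hω σ (0, V) ((mem_plateGraph_iff hA hω hσ1).2 hV) rfl
    obtain ⟨S, hS, hS1, hgen⟩ :=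
      exists_contraction_semigroup (re_inner_plateInv_nonpos hA hω hσ1) hinj
    refine ⟨S, hS, hS1, ?_⟩
    have h : generatorGraph S = plateGraph hA hω σ :=
      Submodule.ext fun P => (hgen P).trans (mem_plateGraph_iff hA hω hσ1).symm
    rw [generator, plateOperator, h]
  · intro S _ hgen
    have hgraph : generatorGraph S = plateGraph hA hω σ := by
      rw [← generator_graph, hgen, plateOperator_graph]
    refine not_isAnalyticSemigroup fun k hk M => ?_
    rw [hgraph]
    have hsω : 0 < √ω := Real.sqrt_pos.2 hω
    -- for `‖z - i / √ω‖ < η` this choice of `η` ensures `Re z + k * Im z > k / (2 * √ω)`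
    set η : ℝ := k / (2 * √ω * (1 + k)) with hη
    have hη0 : 0 < η := by positivity
    have hsmall : ∀ᶠ ν : ℝ in 𝓝 0, √ν * M < k / (2 * √ω) := by
      have h1 : Tendsto (fun ν : ℝ => √ν * M) (𝓝 0) (𝓝 (√0 * M)) :=
        Continuous.tendsto (by fun_prop) 0
      rw [Real.sqrt_zero, zero_mul] at h1
      exact h1.eventually_lt_const (by positivity)
    obtain ⟨ε, hε, hev⟩ := Metric.eventually_nhds_iff.1
      ((eventually_exists_root hω hσ1 hη0).and hsmall)
    obtain ⟨ν, e, hν, hνε, he0, he⟩ := hA.exists_small_eigenvalue hε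
    obtain ⟨⟨z, hz, hzη⟩, hM⟩ := hev (y := ν) (by
      rwa [Real.dist_eq, sub_zero, abs_of_pos hν])
    obtain ⟨U, hU0, hU⟩ := exists_plate_eigenvector hA hω hσ1 hν he0 he hz
    refine ⟨_, U, hU0, hU, ?_⟩
    have hsν : 0 < √ν := Real.sqrt_pos.2 hν
    have hre := (Complex.abs_re_le_norm (z - Complex.I / (√ω : ℝ))).trans_lt hzη
    have him := (Complex.abs_im_le_norm (z - Complex.I / (√ω : ℝ))).trans_lt hzη
    rw [Complex.sub_re, Complex.div_ofReal_re, Complex.I_re, zero_div, sub_zero] at hre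
    rw [Complex.sub_im, Complex.div_ofReal_im, Complex.I_im] at him
    rw [Complex.div_ofReal_re, Complex.div_ofReal_im, mul_div_assoc', ← add_div, lt_div_iff₀ hsν,
      mul_comm]
    have h1 : η * (1 + k) = k / (2 * √ω) := by rw [hη]; field_simp
    have h2 : k * (1 / √ω) = k / (2 * √ω) + k / (2 * √ω) := by field_simp; norm_num
    have h3 := (abs_lt.1 hre).1
    have h4 := mul_lt_mul_of_pos_left (abs_lt.1 him).1 hk
    rw [mul_sub, h2] at h4
    linarith
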